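/- **Proposition (Derivative of the IC TVTV solution map).** Let $\Omega\subset\mathbb R^3$ (coordinates $x,y$ in space, $t$ in time) be a bounded, connected, open set with the segment property: every $z_0\in\partial\Omega$ has a neighbourhood $U$ and a vector $e$ with $z+se\in\Omega$ for all $z\in\overline\Omega\cap U$, $0<s<1$ (this holds for every bounded Lipschitz domain, e.g. a box). Let $g\in L^2(\Omega)$ and $\gamma,\epsilon>0$. For $a,b\in\mathbb R$ let $\nabla_{(a,b)}=(a\partial_x,a\partial_y,b\partial_t):H^1(\Omega)\to L^2(\Omega;\mathbb R^3)$, and let $\mathrm{div}_{(a,b)}:L^2(\Omega;\mathbb R^3)\to H^1(\Omega)^*$ be its negative adjoint, $\langle \mathrm{div}_{(a,b)}p,\varphi\rangle=-\int_\Omega p\cdot\nabla_{(a,b)}\varphi$. Put $\nabla_\kappa=\nabla_{(\kappa,1-\kappa)}$, $\mathrm{div}_\kappa=\mathrm{div}_{(\kappa,1-\kappa)}$. With $H_\gamma(r)=|r|-\gamma/2$ for $|r|\ge\gamma$ and $H_\gamma(r)=|r|^2/(2\gamma)$ for $|r|<\gamma$, let $$\Theta(p)=\int_\Omega H_\gamma(\|p(x)\|_2)\,dx+\tfrac{\epsilon}{2}\|p\|_2^2\qquad(p\in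 L^2(\Omega;\mathbb R^3)),$$ $$J(u,w,\alpha_1,\alpha_2,\kappa)=\tfrac12\|u-g\|_2^2+\alpha_1\Theta(\nabla_\kappa(u-w))+\alpha_2\Theta(\nabla_{1-\kappa}w)+\tfrac12\Big(\int_\Omega w\,dx\Big)^2,\qquad u,w\in H^1(\Omega).$$ Call $(\alpha_1,\alpha_2,\kappa)$ admissible if $\alpha_1,\alpha_2>0$ and $\kappa\in\mathbb R\setminus\{0,1\}$. Then: 1. For every admissible $(\alpha_1,\alpha_2,\kappa)$ the functional $J(\cdot,\cdot,\alpha_1,\alpha_2,\kappa)$ has exactly one minimiser $\hat R(\alpha_1,\alpha_2,\kappa)=(u,w)$ in $H^1(\Omega)\times H^1(\Omega)$. Put $R=P_1\hat R$, where $P_1(u,w)=u$. 2. $\Theta$ is Fréchet differentiable on $L^2(\Omega;\mathbb R^3)$, and for every $(\alpha_1,\alpha_2,\kappa)\in\mathbb R^3$ the functional $J(\cdot,\cdot,\alpha_1,\alpha_2,\kappa)$ is Fréchet differentiable on $H^1(\Omega)\times H^1(\Omega)$. Let $\nabla\Theta$ be the $L^2$ gradient of $\Theta$ and let $S=\nabla_{(u,w)}J$,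 with values in $H^1(\Omega)^*\times H^1(\Omega)^*$. 3. Let $(\alpha_1,\alpha_2,\kappa)$ be admissible and let $(u,w)\in H^1(\Omega)\times H^1(\Omega)$ be such that $$|\{\|\nabla_\kappa(u-w)\|_2=\gamma\}|=|\{\|\nabla_{1-\kappa}w\|_2=\gamma\}|=0.\tag{$*$}$$ Put $\Psi^1_\kappa(v)=[\nabla\Theta](\nabla_\kappa v)$ and let $\Psi^2_\kappa(v)=[\nabla^2\Theta](\nabla_\kappa v)$ be the Gateaux derivative of $\nabla\Theta$ at $\nabla_\kappa v$, a bounded operator on $L^2(\Omega;\mathbb R^3)$. Then $\Psi^2_\kappa(u-w)$ and $\Psi^2_{1-\kappa}(w)$ exist. The map $S$ is Gateaux differentiable with respect to $(u,w)$ and Fréchet differentiable with respect to $(\alpha_1,\alpha_2,\kappa)$, with $$\frac{\partial S}{\partial(u,w)}=Q^*\begin{pmatrix}I-\alpha_1\mathrm{div}_\kappa\Psi^2_\kappa(u-w)\nabla_\kappa& I\\ I& I-\alpha_2\mathrm{div}_{1-\kappa}\Psi^2_{1-\kappa}(w)\nabla_{1-\kappa}+c\otimes c\end{pmatrix}Q,$$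 $$\frac{\partial S}{\partial(\alpha_1,\alpha_2,\kappa)}=Q^*\begin{pmatrix}-\mathrm{div}_\kappa\Psi^1_\kappa(u-w)&0&T_1\\0&-\mathrm{div}_{1-\kappa}\Psi^1_{1-\kappa}(w)&T_2\end{pmatrix},$$ where $Q=\begin{pmatrix}I&-I\\0&I\end{pmatrix}$, $Q^*=\begin{pmatrix}I&0\\-I&I\end{pmatrix}$ is its adjoint, $I:H^1(\Omega)\to H^1(\Omega)^*$ in the first display is given by $\langle Iu,\varphi\rangle=\int_\Omega u\varphi$, $\langle(c\otimes c)w,\varphi\rangle=\int_\Omega w\int_\Omega\varphi$, and $$T_1=-\alpha_1\mathrm{div}_{(1,-1)}\Psi^1_\kappa(u-w)-\alpha_1\mathrm{div}_\kappa\Psi^2_\kappa(u-w)\nabla_{(1,-1)}(u-w),$$ $$T_2=-\alpha_2\mathrm{div}_{(-1,1)}\Psi^1_{1-\kappa}(w)-\alpha_2\mathrm{div}_{1-\kappa}\Psi^2_{1-\kappa}(w)\nabla_{(-1,1)}w.$$ Moreover $\partial S/\partial(u,w):H^1(\Omega)^2\to (H^1(\Omega)^*)^2$ is boundedly invertible.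 4. If $(\alpha_1,\alpha_2,\kappa)$ is admissible and $(u,w)=\hat R(\alpha_1,\alpha_2,\kappa)$ satisfies $(*)$, then $R$ is Fréchet differentiable at $(\alpha_1,\alpha_2,\kappa)$ as a map into $H^1(\Omega)$, and $$\nabla R(\alpha_1,\alpha_2,\kappa)=-P_1\left(\frac{\partial S}{\partial(u,w)}\right)^{-1}\frac{\partial S}{\partial(\alpha_1,\alpha_2,\kappa)},$$ the right-hand side being evaluated at $(u,w)=\hat R(\alpha_1,\alpha_2,\kappa)$. -/

import Mathlib

open MeasureTheory Filter Topology Set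

noncomputable section

namespace ICTVTV

/-! ### Generic notions -/

/-- `A` is the Gateaux derivative of `f` at `x`: all directional derivatives exist (as norm limits)
and are given by the bounded linear operator `A`. -/
def HasGateauxDerivAt {X Y : Type*} [NormedAddCommGroup X] [NormedSpace ℝ X]
    [NormedAddCommGroup Y] [NormedSpace ℝ Y] (f : X → Y) (A : X →L[ℝ] Y) (x : X) : Prop :=
  ∀ h : X, HasDerivAt (fun t : ℝ => f (x + t • h)) (A h) 0

open Classical in
/-- The Gateaux derivative of `f` at `x` (the zero operator if there is none). -/
def gateauxDeriv {X Y : Type*} [NormedAddCommGroup X] [NormedSpace ℝ X]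
    [NormedAddCommGroup Y] [NormedSpace ℝ Y] (f : X → Y) (x : X) : X →L[ℝ] Y :=
  if h : ∃ A : X →L[ℝ] Y, HasGateauxDerivAt f A x then h.choose else 0

/-- The inner product of a real inner product space as a continuous bilinear map. -/
def ip (X : Type*) [NormedAddCommGroup X] [InnerProductSpace ℝ X] : X →L[ℝ] X →L[ℝ] ℝ :=
  (isBoundedBilinearMap_inner (𝕜 := ℝ) (E := X)).toContinuousLinearMap

theorem ip_apply {X : Type*} [NormedAddCommGroup X] [InnerProductSpace ℝ X] (x y : X) :
    ip X x y = inner ℝ x y := rfl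

/-- The block operator `(A B; C D) : X × Y → Z × W`. -/
def block {X Y Z W : Type*} [NormedAddCommGroup X] [NormedSpace ℝ X]
    [NormedAddCommGroup Y] [NormedSpace ℝ Y] [NormedAddCommGroup Z] [NormedSpace ℝ Z]
    [NormedAddCommGroup W] [NormedSpace ℝ W]
    (A : X →L[ℝ] Z) (B : Y →L[ℝ] Z) (C : X →L[ℝ] W) (D : Y →L[ℝ] W) :
    (X × Y) →L[ℝ] (Z × W) :=
  (A.coprod B).prod (C.coprod D)

/-- The operator `ℝ³ → Z`, `(s₁, s₂, s₃) ↦ s₁ c₁ + s₂ c₂ + s₃ c₃`, with columns `c₁, c₂, c₃`. -/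
def columns {Z : Type*} [NormedAddCommGroup Z] [NormedSpace ℝ Z] (c₁ c₂ c₃ : Z) :
    (ℝ × ℝ × ℝ) →L[ℝ] Z :=
  (ContinuousLinearMap.toSpanSingleton ℝ c₁).coprod
    ((ContinuousLinearMap.toSpanSingleton ℝ c₂).coprod
      (ContinuousLinearMap.toSpanSingleton ℝ c₃))

/-! ### The space-time domain, `L²` and `H¹` -/

/-- Space-time `ℝ³`, with coordinates `0, 1` for space `(x, y)` and `2` for time `t`. -/
abbrev E3 : Type := EuclideanSpace ℝ (Fin 3)

/-- A bounded connected domain of `ℝ³` whose boundary is regular in the sense of the segment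
property (satisfied, e.g., by every bounded Lipschitz domain, in particular by every box). -/
structure Domain where
  carrier : Set E3
  isOpen : IsOpen carrier
  isBounded : Bornology.IsBounded carrier
  isConnected : IsConnected carrier
  segment : ∀ x ∈ frontier carrier, ∃ U ∈ 𝓝 x, ∃ e : E3,
    ∀ z ∈ closure carrier ∩ U, ∀ t ∈ Ioo (0 : ℝ) 1, z + t • e ∈ carrier

variable (Ω : Domain)

/-- Lebesgue measure on the domain. -/
abbrev Domain.meas : Measure E3 := volume.restrict Ω.carrier

instance : IsFiniteMeasure Ω.meas :=
  ⟨by simpa using Ω.isBounded.measure_lt_top⟩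

/-- `L²(Ω)` -/
abbrev L2 : Type := Lp ℝ 2 Ω.meas

/-- `L²(Ω; ℝ³)` -/
abbrev L2v : Type := Lp E3 2 Ω.meas

/-- `p` is the weak gradient of `u` on the domain. -/
def IsWeakGrad (u : L2 Ω) (p : L2v Ω) : Prop :=
  ∀ φ : E3 → ℝ, ContDiff ℝ (⊤ : ℕ∞) φ → HasCompactSupport φ → tsupport φ ⊆ Ω.carrier →
    ∀ i : Fin 3,
      ∫ x, u x * fderiv ℝ φ x (EuclideanSpace.single i 1) ∂Ω.meas
        = - ∫ x, p x i * φ x ∂Ω.meas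

variable {Ω} in
theorem integrable_aux (u : E3 → ℝ) (hu : MemLp u 2 Ω.meas) (ψ : E3 → ℝ) (hψ : Continuous ψ)
    (hc : HasCompactSupport ψ) : Integrable (fun x => u x * ψ x) Ω.meas :=
  hu.integrable_mul (q := 2) (hψ.memLp_of_hasCompactSupport hc)

variable {Ω} in
theorem integrable_aux₁ (u : L2 Ω) (φ : E3 → ℝ) (hφ : ContDiff ℝ (⊤ : ℕ∞) φ)
    (hc : HasCompactSupport φ) (e : E3) :
    Integrable (fun x => u x * fderiv ℝ φ x e) Ω.meas :=
  integrable_aux _ (Lp.memLp u) _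
    ((hφ.continuous_fderiv (by simp)).clm_apply continuous_const)
    (hc.fderiv_apply (𝕜 := ℝ) e)

variable {Ω} in
theorem integrable_aux₂ (p : L2v Ω) (φ : E3 → ℝ) (hφ : ContDiff ℝ (⊤ : ℕ∞) φ)
    (hc : HasCompactSupport φ) (i : Fin 3) :
    Integrable (fun x => p x i * φ x) Ω.meas :=
  integrable_aux (fun x => p x i)
    ((EuclideanSpace.proj i : E3 →L[ℝ] ℝ).comp_memLp' (Lp.memLp p)) _
    hφ.continuous hc

/-- The Sobolev space `H¹(Ω)` as a subspace: the pairs `(u, ∇u)` in `L²(Ω) × L²(Ω; ℝ³)`,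
with the Hilbert norm `(‖u‖² + ‖∇u‖²)^(1/2)`. -/
def H1sub : Submodule ℝ (WithLp 2 (L2 Ω × L2v Ω)) where
  carrier := {z | IsWeakGrad Ω z.fst z.snd}
  zero_mem' := by
    intro φ _ _ _ i
    have h1 : ∫ x, (0 : L2 Ω) x * fderiv ℝ φ x (EuclideanSpace.single i 1) ∂Ω.meas = 0 := by
      apply integral_eq_zero_of_ae
      filter_upwards [Lp.coeFn_zero ℝ 2 Ω.meas] with x hx
      rw [hx]
      simp only [Pi.zero_apply, zero_mul]
    have h2 : ∫ x, (0 : L2v Ω) x i * φ x ∂Ω.meas = 0 := by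
      apply integral_eq_zero_of_ae
      filter_upwards [Lp.coeFn_zero E3 2 Ω.meas] with x hx
      rw [hx]
      simp only [Pi.zero_apply, PiLp.zero_apply, zero_mul]
    change ∫ x, (0 : L2 Ω) x * fderiv ℝ φ x (EuclideanSpace.single i 1) ∂Ω.meas
      = - ∫ x, (0 : L2v Ω) x i * φ x ∂Ω.meas
    rw [h1, h2, neg_zero]
  add_mem' := by
    intro z z' hz hz' φ hφ hc hs i
    have h1 : ∫ x, (z.fst + z'.fst : L2 Ω) x * fderiv ℝ φ x (EuclideanSpace.single i 1) ∂Ω.meas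
        = ∫ x, (z.fst x * fderiv ℝ φ x (EuclideanSpace.single i 1)
          + z'.fst x * fderiv ℝ φ x (EuclideanSpace.single i 1)) ∂Ω.meas := by
      apply integral_congr_ae
      filter_upwards [Lp.coeFn_add z.fst z'.fst] with x hx
      rw [hx]
      simp only [Pi.add_apply, add_mul]
    have h2 : ∫ x, (z.snd + z'.snd : L2v Ω) x i * φ x ∂Ω.meas
        = ∫ x, (z.snd x i * φ x + z'.snd x i * φ x) ∂Ω.meas := by
      apply integral_congr_ae
      filter_upwards [Lp.coeFn_add z.snd z'.snd] with x hx
      rw [hx]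
      simp only [Pi.add_apply, PiLp.add_apply, add_mul]
    have e1 := hz φ hφ hc hs i
    have e2 := hz' φ hφ hc hs i
    change ∫ x, (z.fst + z'.fst : L2 Ω) x * fderiv ℝ φ x (EuclideanSpace.single i 1) ∂Ω.meas
      = - ∫ x, (z.snd + z'.snd : L2v Ω) x i * φ x ∂Ω.meas
    rw [h1, h2, integral_add (integrable_aux₁ _ φ hφ hc _) (integrable_aux₁ _ φ hφ hc _),
      integral_add (integrable_aux₂ _ φ hφ hc _) (integrable_aux₂ _ φ hφ hc _), e1, e2]
    ring
  smul_mem' := by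
    intro c z hz φ hφ hc hs i
    have h1 : ∫ x, (c • z.fst : L2 Ω) x * fderiv ℝ φ x (EuclideanSpace.single i 1) ∂Ω.meas
        = ∫ x, c * (z.fst x * fderiv ℝ φ x (EuclideanSpace.single i 1)) ∂Ω.meas := by
      apply integral_congr_ae
      filter_upwards [Lp.coeFn_smul c z.fst] with x hx
      rw [hx]
      simp only [Pi.smul_apply, smul_eq_mul, mul_assoc]
    have h2 : ∫ x, (c • z.snd : L2v Ω) x i * φ x ∂Ω.meas
        = ∫ x, c * (z.snd x i * φ x) ∂Ω.meas := by
      apply integral_congr_ae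
      filter_upwards [Lp.coeFn_smul c z.snd] with x hx
      rw [hx]
      simp only [Pi.smul_apply, PiLp.smul_apply, smul_eq_mul, mul_assoc]
    have e1 := hz φ hφ hc hs i
    change ∫ x, (c • z.fst : L2 Ω) x * fderiv ℝ φ x (EuclideanSpace.single i 1) ∂Ω.meas
      = - ∫ x, (c • z.snd : L2v Ω) x i * φ x ∂Ω.meas
    rw [h1, h2, integral_const_mul, integral_const_mul, e1]
    ring

/-- The Sobolev space `H¹(Ω)` with its Hilbert space structure. -/
def H1 : Type := H1sub Ω

instance : NormedAddCommGroup (H1 Ω) := inferInstanceAs (NormedAddCommGroup (H1sub Ω))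

instance : InnerProductSpace ℝ (H1 Ω) := inferInstanceAs (InnerProductSpace ℝ (H1sub Ω))

/-- The inclusion of `H¹(Ω)` into `L²(Ω) × L²(Ω; ℝ³)`. -/
def H1incl : H1 Ω →L[ℝ] WithLp 2 (L2 Ω × L2v Ω) := (H1sub Ω).subtypeL

/-- The dual space `H¹(Ω)*`. -/
abbrev H1dual : Type := H1 Ω →L[ℝ] ℝ

/-- The embedding `H¹(Ω) → L²(Ω)`. -/
def toL2 : H1 Ω →L[ℝ] L2 Ω := (WithLp.fstL 2 ℝ (L2 Ω) (L2v Ω)).comp (H1incl Ω)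

/-- The gradient `∇ : H¹(Ω) → L²(Ω; ℝ³)`. -/
def grad : H1 Ω →L[ℝ] L2v Ω := (WithLp.sndL 2 ℝ (L2 Ω) (L2v Ω)).comp (H1incl Ω)

/-- The weighted gradient `(a ∂/∂x, a ∂/∂y, b ∂/∂t)`. -/
def wgrad (a b : ℝ) : H1 Ω →L[ℝ] L2v Ω :=
  (ContinuousLinearMap.compLpL 2 Ω.meas
    (Matrix.toEuclideanCLM (n := Fin 3) (𝕜 := ℝ) (Matrix.diagonal ![a, a, b]))).comp (grad Ω)

/-- The weighted divergence `a ∂/∂x + a ∂/∂y + b ∂/∂t : L²(Ω; ℝ³) → H¹(Ω)*`, the negative adjoint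
of the weighted gradient: `⟨wdiv a b p, φ⟩ = - ∫ p · wgrad a b φ`. -/
def wdiv (a b : ℝ) : L2v Ω →L[ℝ] H1dual Ω :=
  -((ip (L2v Ω)).bilinearComp (ContinuousLinearMap.id ℝ (L2v Ω)) (wgrad Ω a b))

/-- `∇_κ = (κ ∂/∂x, κ ∂/∂y, (1 - κ) ∂/∂t)` -/
def gradK (κ : ℝ) : H1 Ω →L[ℝ] L2v Ω := wgrad Ω κ (1 - κ)

/-- `div_κ = κ ∂/∂x + κ ∂/∂y + (1 - κ) ∂/∂t`, the negative adjoint of `∇_κ`. -/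
def divK (κ : ℝ) : L2v Ω →L[ℝ] H1dual Ω := wdiv Ω κ (1 - κ)

/-- The identity as an operator `I : H¹(Ω) → H¹(Ω)*`, i.e. `⟨I u, φ⟩ = ∫ u φ`. -/
def idDual : H1 Ω →L[ℝ] H1dual Ω := (ip (L2 Ω)).bilinearComp (toL2 Ω) (toL2 Ω)

/-- The constant function `c = χ_Ω` in `L²(Ω)`. -/
def cOne : L2 Ω := (memLp_const (1 : ℝ)).toLp (fun _ => (1 : ℝ))

/-- The functional `⟨c, ·⟩` on `H¹(Ω)`. -/
def cDual : H1dual Ω := (ip (L2 Ω) (cOne Ω)).comp (toL2 Ω)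

/-- `c ⊗ c : H¹(Ω) → H¹(Ω)*`, `w ↦ ⟨c, w⟩ c`. -/
def cTensor : H1 Ω →L[ℝ] H1dual Ω := (cDual Ω).smulRight (cDual Ω)

/-! ### The lower-level problem -/

/-- The Huber function `H_γ`. -/
def huber (γ r : ℝ) : ℝ := if γ ≤ |r| then |r| - γ / 2 else 1 / (2 * γ) * |r| ^ 2

variable {Ω}

/-- `Θ(p) = ‖p‖_γ + (ε/2) ‖p‖²` on `L²(Ω; ℝ³)`. -/
def Theta (γ ε : ℝ) (p : L2v Ω) : ℝ :=
  ∫ x, huber γ ‖p x‖ ∂Ω.meas + ε / 2 * ‖p‖ ^ 2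

/-- The lower-level functional `J_{γ,ε}(u, w, α₁, α₂, κ)`; here `U = (u, w)`, `a = (α₁, α₂, κ)`. -/
def J (g : L2 Ω) (γ ε : ℝ) (U : H1 Ω × H1 Ω) (a : ℝ × ℝ × ℝ) : ℝ :=
  1 / 2 * ‖toL2 Ω U.1 - g‖ ^ 2
    + a.1 * Theta γ ε (gradK Ω a.2.2 (U.1 - U.2))
    + a.2.1 * Theta γ ε (gradK Ω (1 - a.2.2) U.2)
    + 1 / 2 * (∫ x, toL2 Ω U.2 x ∂Ω.meas) ^ 2

/-- `U` minimises `J_{γ,ε}(·, a)` over `H¹(Ω) × H¹(Ω)`. -/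
def IsMinimiser (g : L2 Ω) (γ ε : ℝ) (a : ℝ × ℝ × ℝ) (U : H1 Ω × H1 Ω) : Prop :=
  ∀ V : H1 Ω × H1 Ω, J g γ ε U a ≤ J g γ ε V a

open Classical in
/-- The solution map `a = (α₁, α₂, κ) ↦ argmin J_{γ,ε}(·, a)`. -/
def Rhat (g : L2 Ω) (γ ε : ℝ) (a : ℝ × ℝ × ℝ) : H1 Ω × H1 Ω :=
  if h : ∃ U, IsMinimiser g γ ε a U then h.choose else 0

variable (Ω) in
/-- `P₁(u, w) = u` -/
def P₁ : (H1 Ω × H1 Ω) →L[ℝ] H1 Ω := ContinuousLinearMap.fst ℝ (H1 Ω) (H1 Ω)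

/-- `R = P₁ R̂_{γ,ε}` -/
def R (g : L2 Ω) (γ ε : ℝ) (a : ℝ × ℝ × ℝ) : H1 Ω := P₁ Ω (Rhat g γ ε a)

/-- Admissible parameters: `α₁, α₂ > 0` and `κ ∉ {0, 1}`. -/
def Admissible (a : ℝ × ℝ × ℝ) : Prop := 0 < a.1 ∧ 0 < a.2.1 ∧ a.2.2 ≠ 0 ∧ a.2.2 ≠ 1

/-- For `U = (u, w)`: the sets `{‖∇_κ(u - w)‖ = γ}` and `{‖∇_{1-κ} w‖ = γ}`, where the integrand
of `Θ` is not twice differentiable, are Lebesgue-null. -/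
def AwayFromKink (γ κ : ℝ) (U : H1 Ω × H1 Ω) : Prop :=
  ∀ᵐ x ∂Ω.meas, ‖gradK Ω κ (U.1 - U.2) x‖ ≠ γ ∧ ‖gradK Ω (1 - κ) U.2 x‖ ≠ γ

/-! ### The Euler-Lagrange operator and its derivatives -/

/-- `S = ∇_{(u,w)} J_{γ,ε} = (∂J/∂u, ∂J/∂w)`, with values in `H¹(Ω)* × H¹(Ω)*`. -/
def S (g : L2 Ω) (γ ε : ℝ) (U : H1 Ω × H1 Ω) (a : ℝ × ℝ × ℝ) : H1dual Ω × H1dual Ω :=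
  ((fderiv ℝ (fun V => J g γ ε V a) U).comp (ContinuousLinearMap.inl ℝ (H1 Ω) (H1 Ω)),
   (fderiv ℝ (fun V => J g γ ε V a) U).comp (ContinuousLinearMap.inr ℝ (H1 Ω) (H1 Ω)))

/-- `Ψ¹_κ(v) = [∇Θ](∇_κ v)`, the `L²` gradient of `Θ`. -/
def Psi1 (γ ε κ : ℝ) (v : H1 Ω) : L2v Ω := gradient (Theta (Ω := Ω) γ ε) (gradK Ω κ v)

/-- `Ψ²_κ(v) = [∇²Θ](∇_κ v)`, the (Gateaux) derivative of `∇Θ`. -/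
def Psi2 (γ ε κ : ℝ) (v : H1 Ω) : L2v Ω →L[ℝ] L2v Ω :=
  gateauxDeriv (gradient (Theta (Ω := Ω) γ ε)) (gradK Ω κ v)

variable (Ω) in
/-- `Q = (I, -I; 0, I)` -/
def Q : (H1 Ω × H1 Ω) →L[ℝ] (H1 Ω × H1 Ω) :=
  block (ContinuousLinearMap.id ℝ (H1 Ω)) (-ContinuousLinearMap.id ℝ (H1 Ω))
    0 (ContinuousLinearMap.id ℝ (H1 Ω))

variable (Ω) in
/-- `Q* = (I, 0; -I, I)` -/
def Qstar : (H1dual Ω × H1dual Ω) →L[ℝ] (H1dual Ω × H1dual Ω) :=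
  block (ContinuousLinearMap.id ℝ (H1dual Ω)) 0
    (-ContinuousLinearMap.id ℝ (H1dual Ω)) (ContinuousLinearMap.id ℝ (H1dual Ω))

/-- `Qstar` is the adjoint of `Q` for the duality `⟨(a, b), (u, w)⟩ = a u + b w`. -/
theorem Qstar_adjoint (A : H1dual Ω × H1dual Ω) (U : H1 Ω × H1 Ω) :
    (Qstar Ω A).1 U.1 + (Qstar Ω A).2 U.2 = A.1 (Q Ω U).1 + A.2 (Q Ω U).2 := by
  simp [Q, Qstar, block]
  ring

/-- The operator
`Q* (I - α₁ div_κ Ψ²_κ(u-w) ∇_κ,  I;  I,  I - α₂ div_{1-κ} Ψ²_{1-κ}(w) ∇_{1-κ} + c ⊗ c) Q`. -/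
def dS_dU (γ ε : ℝ) (U : H1 Ω × H1 Ω) (a : ℝ × ℝ × ℝ) :
    (H1 Ω × H1 Ω) →L[ℝ] (H1dual Ω × H1dual Ω) :=
  (Qstar Ω).comp ((block
    (idDual Ω
      - a.1 • (divK Ω a.2.2).comp ((Psi2 γ ε a.2.2 (U.1 - U.2)).comp (gradK Ω a.2.2)))
    (idDual Ω)
    (idDual Ω)
    (idDual Ω
      - a.2.1 • (divK Ω (1 - a.2.2)).comp
          ((Psi2 γ ε (1 - a.2.2) U.2).comp (gradK Ω (1 - a.2.2)))
      + cTensor Ω)).comp (Q Ω))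

/-- `T₁ = -α₁ (div - ∂/∂t) Ψ¹_κ(u-w) - α₁ div_κ Ψ²_κ(u-w) (∇ - ∂/∂t)(u-w)`, where `∇ - ∂/∂t` stands
for `(∂/∂x, ∂/∂y, -∂/∂t)` and `div - ∂/∂t` for its negative adjoint. -/
def T₁ (γ ε : ℝ) (U : H1 Ω × H1 Ω) (a : ℝ × ℝ × ℝ) : H1dual Ω :=
  -(a.1 • wdiv Ω 1 (-1) (Psi1 γ ε a.2.2 (U.1 - U.2)))
    - a.1 • divK Ω a.2.2 (Psi2 γ ε a.2.2 (U.1 - U.2) (wgrad Ω 1 (-1) (U.1 - U.2)))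

/-- `T₂ = -α₂ (∂/∂t - div) Ψ¹_{1-κ}(w) - α₂ div_{1-κ} Ψ²_{1-κ}(w) (∂/∂t - ∇) w`, where `∂/∂t - ∇`
stands for `(-∂/∂x, -∂/∂y, ∂/∂t)` and `∂/∂t - div` for its negative adjoint. -/
def T₂ (γ ε : ℝ) (U : H1 Ω × H1 Ω) (a : ℝ × ℝ × ℝ) : H1dual Ω :=
  -(a.2.1 • wdiv Ω (-1) 1 (Psi1 γ ε (1 - a.2.2) U.2))
    - a.2.1 • divK Ω (1 - a.2.2) (Psi2 γ ε (1 - a.2.2) U.2 (wgrad Ω (-1) 1 U.2))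

/-- The operator `Q* (-div_κ Ψ¹_κ(u-w), 0, T₁;  0, -div_{1-κ} Ψ¹_{1-κ}(w), T₂)`. -/
def dS_da (γ ε : ℝ) (U : H1 Ω × H1 Ω) (a : ℝ × ℝ × ℝ) :
    (ℝ × ℝ × ℝ) →L[ℝ] (H1dual Ω × H1dual Ω) :=
  (Qstar Ω).comp (columns
    (-(divK Ω a.2.2 (Psi1 γ ε a.2.2 (U.1 - U.2))), 0)
    (0, -(divK Ω (1 - a.2.2) (Psi1 γ ε (1 - a.2.2) U.2)))
    (T₁ γ ε U a, T₂ γ ε U a))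

end ICTVTV

end

/-! Away from the kink sets, which are null by hypothesis, `huberGrad` is differentiable at almost
every value taken. The superposition operator it induces on `L²` is nevertheless in general only
Gateaux differentiable, so the classical implicit function theorem does not apply to `S`. Two facts
replace it.

First, `∇Θ` is globally Lipschitz, and a Lipschitz, Gateaux differentiable map composed with a
Fréchet differentiable map on a finite-dimensional space is Fréchet differentiable
(`HasGateauxDerivAt.comp_hasFDerivAt`). The parameter space is `ℝ³`, so this suffices. Second, the
Euler-Lagrange operator is strongly monotone, so the distance from any `V` to the minimiser is
bounded by the residual of `V`, with a constant that is locally uniform in the parameters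
(`norm_sub_Rhat_le`). Put `L = -(∂S/∂U)⁻¹ ∂S/∂a`. Along the affine trial `b ↦ U + L (b - a)` the
residual vanishes at `a` together with its derivative, so it is `o(b - a)`. Hence so is the distance
from the trial to the minimiser, and `L` is the derivative.

Existence, uniqueness, strong monotonicity and (by Lax-Milgram) invertibility all rest on the
coercivity of `quadForm`. The `ε` terms control the gradients of `u - w` and `w` because `κ ≠ 0, 1`;
the fidelity term controls `u` in `L²`; the mean of `w` and the Poincaré inequality control `w` in
`L²`. The Poincaré inequality is obtained without compact embeddings. A translation estimate moves
`L²` mass along segments inside the domain. Connectedness reaches every compact subset from one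
ball, the segment property reaches the boundary, and on the ball a double integral of differences
gives the bound. -/

noncomputable section

namespace ICTVTV

section

/-! ### The Huber function of the norm on an inner product space -/

section Pointwise

variable {E : Type*} [NormedAddCommGroup E] [InnerProductSpace ℝ E] {γ : ℝ}

/-- The gradient `v ↦ v / max(γ, ‖v‖)` of `v ↦ H_γ(‖v‖)`. -/
def huberGrad (γ : ℝ) (v : E) : E := (max γ ‖v‖)⁻¹ • v

@[simp] theorem huberGrad_zero : huberGrad γ (0 : E) = 0 := by simp [huberGrad]

theorem norm_huberGrad (hγ : 0 < γ) (v : E) : ‖huberGrad γ v‖ = ‖v‖ / max γ ‖v‖ := by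
  have hM : 0 < max γ ‖v‖ := lt_max_of_lt_left hγ
  rw [huberGrad, norm_smul, norm_inv, Real.norm_of_nonneg hM.le]
  field_simp

theorem norm_huberGrad_le_one (hγ : 0 < γ) (v : E) : ‖huberGrad γ v‖ ≤ 1 := by
  rw [norm_huberGrad hγ]
  exact div_le_one_of_le₀ (le_max_right _ _) (lt_max_of_lt_left hγ).le

/-- With `M`, `N` the two maxima, `v/M - w/N = M⁻¹ ((v - w) + (N - M) w/N)`, where `M ≥ γ`, `|N - M|
≤ ‖v - w‖` and `‖w/N‖ ≤ 1`. The sharp constant is `1/γ`, since `huberGrad γ v` is the projection of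
`v/γ` onto the unit ball, but any constant will do. -/
theorem norm_huberGrad_sub_le (hγ : 0 < γ) (v w : E) :
    ‖huberGrad γ v - huberGrad γ w‖ ≤ 2 / γ * ‖v - w‖ := by
  have hM : 0 < max γ ‖v‖ := lt_max_of_lt_left hγ
  have hN : 0 < max γ ‖w‖ := lt_max_of_lt_left hγ
  have key : huberGrad γ v - huberGrad γ w
      = (max γ ‖v‖)⁻¹ • ((v - w) + (max γ ‖w‖ - max γ ‖v‖) • huberGrad γ w) := by
    simp only [huberGrad, smul_add, smul_sub, smul_smul, sub_mul, sub_smul]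
    rw [mul_inv_cancel₀ hN.ne', mul_one, inv_mul_cancel_left₀ hM.ne']
    abel
  have h1 : |max γ ‖w‖ - max γ ‖v‖| ≤ ‖v - w‖ := by
    calc |max γ ‖w‖ - max γ ‖v‖| ≤ |‖w‖ - ‖v‖| := by
          rw [max_comm γ, max_comm γ]; exact abs_max_sub_max_le_abs _ _ _
      _ ≤ ‖w - v‖ := abs_norm_sub_norm_le _ _
      _ = ‖v - w‖ := norm_sub_rev _ _
  have h2 : ‖(v - w) + (max γ ‖w‖ - max γ ‖v‖) • huberGrad γ w‖ ≤ 2 * ‖v - w‖ := by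
    refine (norm_add_le _ _).trans ?_
    rw [norm_smul, Real.norm_eq_abs]
    have := mul_le_mul h1 (norm_huberGrad_le_one hγ w) (norm_nonneg _) (norm_nonneg _)
    linarith
  rw [key, norm_smul, norm_inv, Real.norm_of_nonneg hM.le]
  have h3 : (max γ ‖v‖)⁻¹ ≤ γ⁻¹ := inv_anti₀ hγ (le_max_left _ _)
  calc (max γ ‖v‖)⁻¹ * _ ≤ γ⁻¹ * (2 * ‖v - w‖) :=
        mul_le_mul h3 h2 (norm_nonneg _) (inv_nonneg.2 hγ.le)
    _ = 2 / γ * ‖v - w‖ := by ring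

theorem lipschitzWith_huberGrad (hγ : 0 < γ) :
    LipschitzWith (2 / γ).toNNReal (huberGrad γ : E → E) :=
  LipschitzWith.of_dist_le_mul fun v w => by
    rw [dist_eq_norm, dist_eq_norm, Real.coe_toNNReal _ (by positivity)]
    exact norm_huberGrad_sub_le hγ v w

/-- `H_γ(‖v‖) = ⟨q, v⟩ - γ ‖q‖² / 2` for the maximiser `q = huberGrad γ v`. -/
theorem huber_norm_eq (hγ : 0 < γ) (v : E) :
    huber γ ‖v‖ = inner ℝ (huberGrad γ v) v - γ / 2 * ‖huberGrad γ v‖ ^ 2 := by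
  rw [norm_huberGrad hγ, huberGrad, real_inner_smul_left, real_inner_self_eq_norm_sq, huber,
    abs_norm]
  split_ifs with h
  · have : 0 < ‖v‖ := hγ.trans_le h
    rw [max_eq_right h, div_self this.ne']
    field_simp
  · rw [max_eq_left (not_le.1 h).le]
    field_simp
    ring

/-- Fenchel-Young: `H_γ(‖·‖)` is the supremum over the unit ball of these affine functions, and
`huber_norm_eq` says that it is attained. Convexity follows. After Cauchy-Schwarz the gap is `(1 -
‖q‖)(‖v‖ - γ) + γ/2 (1 - ‖q‖)²` in the linear regime and a square in the quadratic one. -/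
theorem le_huber_norm (hγ : 0 < γ) {q : E} (hq : ‖q‖ ≤ 1) (v : E) :
    inner ℝ q v - γ / 2 * ‖q‖ ^ 2 ≤ huber γ ‖v‖ := by
  have h0 := norm_nonneg q
  have h1 := real_inner_le_norm q v
  rw [huber, abs_norm]
  split_ifs with h
  · nlinarith [mul_nonneg (sub_nonneg.2 hq) (sub_nonneg.2 h), sq_nonneg (1 - ‖q‖)]
  · have : 1 / (2 * γ) * ‖v‖ ^ 2 - (‖q‖ * ‖v‖ - γ / 2 * ‖q‖ ^ 2)
        = 1 / (2 * γ) * (‖v‖ - γ * ‖q‖) ^ 2 := by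
      field_simp
      ring
    have h2 : 0 ≤ 1 / (2 * γ) * (‖v‖ - γ * ‖q‖) ^ 2 := by positivity
    linarith

/-- Convexity: the subgradient inequality for `H_γ(‖·‖)`. -/
theorem huber_norm_add_inner_le (hγ : 0 < γ) (v w : E) :
    huber γ ‖v‖ + inner ℝ (huberGrad γ v) (w - v) ≤ huber γ ‖w‖ := by
  have := le_huber_norm hγ (norm_huberGrad_le_one hγ v) w
  rw [huber_norm_eq hγ v, inner_sub_right]
  linarith

/-- The subgradient inequality based at `w`, with `huberGrad γ w` exchanged for `huberGrad γ v` at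
the cost of the Lipschitz bound. -/
theorem huber_norm_le_add (hγ : 0 < γ) (v w : E) :
    huber γ ‖w‖ ≤ huber γ ‖v‖ + inner ℝ (huberGrad γ v) (w - v) + 2 / γ * ‖w - v‖ ^ 2 := by
  have h1 := huber_norm_add_inner_le hγ w v
  have h2 := real_inner_le_norm (huberGrad γ w - huberGrad γ v) (w - v)
  have h3 := mul_le_mul_of_nonneg_right (norm_huberGrad_sub_le hγ w v) (norm_nonneg (w - v))
  have h4 : inner ℝ (huberGrad γ w) (v - w) = - inner ℝ (huberGrad γ w) (w - v) := by
    rw [← inner_neg_right, neg_sub]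
  rw [inner_sub_left] at h2
  rw [h4] at h1
  nlinarith

theorem huber_norm_nonneg (hγ : 0 < γ) (v : E) : 0 ≤ huber γ ‖v‖ := by
  simpa using le_huber_norm (q := 0) hγ (by simp) v

theorem huber_norm_le (hγ : 0 < γ) (v : E) : huber γ ‖v‖ ≤ 2 / γ * ‖v‖ ^ 2 := by
  have := huber_norm_le_add hγ 0 v
  simpa [huber, hγ.not_ge] using this

theorem continuous_huberGrad (hγ : 0 < γ) : Continuous (huberGrad γ : E → E) :=
  (lipschitzWith_huberGrad hγ).continuous

theorem continuous_huber_norm (hγ : 0 < γ) : Continuous fun v : E => huber γ ‖v‖ := by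
  simp_rw [huber_norm_eq hγ]
  have := continuous_huberGrad (E := E) hγ
  fun_prop

theorem differentiableAt_huberGrad (hγ : 0 < γ) {v : E} (hv : ‖v‖ ≠ γ) :
    DifferentiableAt ℝ (huberGrad γ) v := by
  rcases lt_or_gt_of_ne hv with h | h
  · have : (huberGrad γ : E → E) =ᶠ[𝓝 v] fun w => γ⁻¹ • w := by
      filter_upwards [continuous_norm.continuousAt.eventually_lt_const h] with w hw
      rw [huberGrad, max_eq_left hw.le]
    exact (differentiableAt_id.const_smul γ⁻¹).congr_of_eventuallyEq this
  · have : (huberGrad γ : E → E) =ᶠ[𝓝 v] fun w => ‖w‖⁻¹ • w := by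
      filter_upwards [continuous_norm.continuousAt.eventually_const_lt h] with w hw
      rw [huberGrad, max_eq_right hw.le]
    have hv0 : v ≠ 0 := by rintro rfl; simp at h; linarith
    refine DifferentiableAt.congr_of_eventuallyEq ?_ this
    exact ((differentiableAt_id.norm ℝ hv0).inv (norm_ne_zero_iff.2 hv0)).smul differentiableAt_id

end Pointwise

end

section

/-! ### Differentiability of `Θ` and of its gradient -/

section Lp

variable {α E : Type*} [MeasurableSpace α] {μ : Measure α} [NormedAddCommGroup E]

theorem integrable_norm_sq (p : Lp E 2 μ) : Integrable (fun x => ‖p x‖ ^ 2) μ :=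
  (Lp.memLp p).integrable_norm_pow (by norm_num)

theorem Lp_norm_sq (p : Lp E 2 μ) : ‖p‖ ^ 2 = ∫ x, ‖p x‖ ^ 2 ∂μ := by
  rw [Lp.norm_def, eLpNorm_eq_lintegral_rpow_enorm_toReal (by norm_num) (by norm_num)]
  rw [integral_eq_lintegral_of_nonneg_ae (f := fun x => ‖p x‖ ^ 2)
    (Eventually.of_forall fun x => sq_nonneg _) ((Lp.aestronglyMeasurable p).norm.pow 2)]
  simp only [ENNReal.toReal_ofNat, one_div]
  rw [← ENNReal.toReal_rpow, ← Real.rpow_natCast, ← Real.rpow_mul ENNReal.toReal_nonneg]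
  norm_num

theorem lintegral_enorm_sq (p : Lp E 2 μ) : ∫⁻ x, ‖p x‖ₑ ^ 2 ∂μ = ENNReal.ofReal (‖p‖ ^ 2) := by
  rw [Lp_norm_sq, ofReal_integral_eq_lintegral_ofReal (integrable_norm_sq p)
    (Eventually.of_forall fun x => sq_nonneg _)]
  refine lintegral_congr fun x => ?_
  rw [← ofReal_norm, ENNReal.ofReal_pow (norm_nonneg _)]

end Lp

variable {Ω : Domain} {γ ε : ℝ}

/-- The superposition operator `p ↦ huberGrad γ ∘ p` on `L²(Ω; ℝ³)`. -/
def huberOp (Ω : Domain) (hγ : 0 < γ) (p : L2v Ω) : L2v Ω :=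
  (lipschitzWith_huberGrad (E := E3) hγ).compLp huberGrad_zero p

theorem coeFn_huberOp (hγ : 0 < γ) (p : L2v Ω) :
    huberOp Ω hγ p =ᵐ[Ω.meas] fun x => huberGrad γ (p x) :=
  (lipschitzWith_huberGrad (E := E3) hγ).coeFn_compLp huberGrad_zero p

theorem lipschitzWith_huberOp (hγ : 0 < γ) :
    LipschitzWith (2 / γ).toNNReal (huberOp Ω hγ) :=
  (lipschitzWith_huberGrad (E := E3) hγ).lipschitzWith_compLp huberGrad_zero

theorem integrable_huber (hγ : 0 < γ) (p : L2v Ω) :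
    Integrable (fun x => huber γ ‖p x‖) Ω.meas := by
  refine ((integrable_norm_sq p).const_mul (2 / γ)).mono'
    ((continuous_huber_norm hγ).comp_aestronglyMeasurable (Lp.aestronglyMeasurable p))
    (Eventually.of_forall fun x => ?_)
  rw [Real.norm_of_nonneg (huber_norm_nonneg hγ _)]
  exact huber_norm_le hγ _

theorem integral_inner_huberGrad (hγ : 0 < γ) (p q : L2v Ω) :
    inner ℝ (huberOp Ω hγ p) (q - p)
      = ∫ x, inner ℝ (huberGrad γ (p x)) (q x - p x) ∂Ω.meas := by
  rw [L2.inner_def]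
  refine integral_congr_ae ?_
  filter_upwards [coeFn_huberOp hγ p, Lp.coeFn_sub q p] with x h1 h2
  rw [h1, h2, Pi.sub_apply]

theorem integrable_inner_huberGrad (hγ : 0 < γ) (p q : L2v Ω) :
    Integrable (fun x => inner ℝ (huberGrad γ (p x)) (q x - p x)) Ω.meas := by
  refine (L2.integrable_inner (𝕜 := ℝ) (huberOp Ω hγ p) (q - p)).congr ?_
  filter_upwards [coeFn_huberOp hγ p, Lp.coeFn_sub q p] with x h1 h2
  rw [h1, h2, Pi.sub_apply]

/-- The gradient of `Θ`. -/
def thetaGrad (Ω : Domain) (hγ : 0 < γ) (ε : ℝ) (p : L2v Ω) : L2v Ω := huberOp Ω hγ p + ε • p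

theorem norm_sq_eq_add {X : Type*} [NormedAddCommGroup X] [InnerProductSpace ℝ X] (p q : X) :
    ‖q‖ ^ 2 = ‖p‖ ^ 2 + 2 * inner ℝ p (q - p) + ‖q - p‖ ^ 2 := by
  have := norm_add_sq_real p (q - p)
  rwa [add_sub_cancel] at this

/-- `Θ` is strongly convex. -/
theorem theta_add_inner_le (hγ : 0 < γ) (p q : L2v Ω) :
    Theta γ ε p + inner ℝ (thetaGrad Ω hγ ε p) (q - p) + ε / 2 * ‖q - p‖ ^ 2 ≤ Theta γ ε q := by
  have h := integral_mono ((integrable_huber hγ p).add (integrable_inner_huberGrad hγ p q))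
    (integrable_huber hγ q) fun x => huber_norm_add_inner_le hγ (p x) (q x)
  simp only [Pi.add_apply] at h
  rw [integral_add (integrable_huber hγ p) (integrable_inner_huberGrad hγ p q),
    ← integral_inner_huberGrad hγ] at h
  rw [Theta, Theta, thetaGrad, inner_add_left, real_inner_smul_left, norm_sq_eq_add p q]
  linarith

theorem theta_le_add (hγ : 0 < γ) (p q : L2v Ω) :
    Theta γ ε q ≤ Theta γ ε p + inner ℝ (thetaGrad Ω hγ ε p) (q - p)
      + (2 / γ + ε / 2) * ‖q - p‖ ^ 2 := by
  have e : ‖q - p‖ ^ 2 = ∫ x, ‖q x - p x‖ ^ 2 ∂Ω.meas := by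
    rw [Lp_norm_sq]
    refine integral_congr_ae ?_
    filter_upwards [Lp.coeFn_sub q p] with x h2
    rw [h2, Pi.sub_apply]
  have hi : Integrable (fun x => 2 / γ * ‖q x - p x‖ ^ 2) Ω.meas := by
    refine ((integrable_norm_sq (q - p)).congr ?_).const_mul _
    filter_upwards [Lp.coeFn_sub q p] with x h2
    rw [h2, Pi.sub_apply]
  have h := integral_mono (integrable_huber hγ q)
    (((integrable_huber hγ p).add (integrable_inner_huberGrad hγ p q)).add hi)
    fun x => huber_norm_le_add hγ (p x) (q x)
  simp only [Pi.add_apply] at h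
  rw [integral_add (f := fun x => huber γ ‖p x‖ + inner ℝ (huberGrad γ (p x)) (q x - p x))
      ((integrable_huber hγ p).add (integrable_inner_huberGrad hγ p q)) hi,
    integral_add (integrable_huber hγ p) (integrable_inner_huberGrad hγ p q),
    ← integral_inner_huberGrad hγ, integral_const_mul, ← e] at h
  rw [Theta, Theta, thetaGrad, inner_add_left, real_inner_smul_left, norm_sq_eq_add p q]
  linarith

/-- Convexity and the quadratic upper bound squeeze the first-order remainder between `0` and a
multiple of `‖q - p‖²`. Kinks play no role at first order. -/
theorem hasGradientAt_theta (hγ : 0 < γ) (hε : 0 < ε) (p : L2v Ω) :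
    HasGradientAt (Theta γ ε) (thetaGrad Ω hγ ε p) p := by
  rw [hasGradientAt_iff_isLittleO]
  have hC : 0 < 2 / γ + ε / 2 := by positivity
  have h1 : (fun q : L2v Ω => Theta γ ε q - Theta γ ε p - inner ℝ (thetaGrad Ω hγ ε p) (q - p))
      =O[𝓝 p] fun q => ‖q - p‖ ^ 2 := by
    refine Asymptotics.IsBigO.of_bound (2 / γ + ε / 2) (Eventually.of_forall fun q => ?_)
    have a1 := theta_add_inner_le (ε := ε) hγ p q
    have a2 := theta_le_add (ε := ε) hγ p q
    have a3 : 0 ≤ ε / 2 * ‖q - p‖ ^ 2 := by positivity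
    rw [Real.norm_of_nonneg (by linarith), norm_pow, norm_norm]
    linarith
  exact h1.trans_isLittleO (Asymptotics.isLittleO_pow_sub_sub p one_lt_two)

theorem gradient_theta (hγ : 0 < γ) (hε : 0 < ε) :
    gradient (Theta (Ω := Ω) γ ε) = thetaGrad Ω hγ ε :=
  funext fun p => (hasGradientAt_theta hγ hε p).gradient

theorem lipschitzWith_thetaGrad (hγ : 0 < γ) (ε : ℝ) :
    LipschitzWith ((2 / γ).toNNReal + ‖ε‖₊) (thetaGrad Ω hγ ε) :=
  (lipschitzWith_huberOp hγ).add (lipschitzWith_smul ε)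

/-- `∇Θ` is strongly monotone. -/
theorem inner_thetaGrad_sub_ge (hγ : 0 < γ) (p q : L2v Ω) :
    ε * ‖p - q‖ ^ 2 ≤ inner ℝ (thetaGrad Ω hγ ε p - thetaGrad Ω hγ ε q) (p - q) := by
  have h1 := theta_add_inner_le (ε := ε) hγ p q
  have h2 := theta_add_inner_le (ε := ε) hγ q p
  have h4 : inner ℝ (thetaGrad Ω hγ ε p) (q - p) = - inner ℝ (thetaGrad Ω hγ ε p) (p - q) := by
    rw [← inner_neg_right, neg_sub]
  rw [norm_sub_rev q p] at h1
  rw [inner_sub_left]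
  linarith

/-- Holds on the kink too, where `fderiv` may take its default value `0`; the multiplication
operator `huberHess` is therefore bounded for every `p`. -/
theorem norm_fderiv_huberGrad_le (hγ : 0 < γ) (v : E3) :
    ‖fderiv ℝ (huberGrad γ) v‖ ≤ 2 / γ := by
  have := norm_fderiv_le_of_lipschitz ℝ (lipschitzWith_huberGrad (E := E3) hγ) (x₀ := v)
  rwa [Real.coe_toNNReal _ (by positivity)] at this

theorem memLp_fderiv_huberGrad (hγ : 0 < γ) (p q : L2v Ω) :
    MemLp (fun x => fderiv ℝ (huberGrad γ) (p x) (q x)) 2 Ω.meas := by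
  refine (Lp.memLp q).of_le_mul (c := 2 / γ) ?_ (Eventually.of_forall fun x =>
    ContinuousLinearMap.le_of_opNorm_le _ (norm_fderiv_huberGrad_le hγ _) _)
  have h := ((measurable_fderiv ℝ (huberGrad γ : E3 → E3)).comp_aemeasurable
    (Lp.aestronglyMeasurable p).aemeasurable).aestronglyMeasurable
  exact (ContinuousLinearMap.id ℝ (E3 →L[ℝ] E3)).aestronglyMeasurable_comp₂ h
    (Lp.aestronglyMeasurable q)

/-- The multiplication operator `q ↦ (x ↦ D(huberGrad γ)(p x) (q x))`. -/
def huberHess (Ω : Domain) (hγ : 0 < γ) (p : L2v Ω) : L2v Ω →L[ℝ] L2v Ω :=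
  LinearMap.mkContinuous
    { toFun := fun q => (memLp_fderiv_huberGrad hγ p q).toLp _
      map_add' := fun q r => by
        rw [← MemLp.toLp_add, MemLp.toLp_eq_toLp_iff]
        filter_upwards [Lp.coeFn_add q r] with x hx
        rw [hx, Pi.add_apply, map_add, Pi.add_apply]
      map_smul' := fun c q => by
        rw [RingHom.id_apply, ← MemLp.toLp_const_smul, MemLp.toLp_eq_toLp_iff]
        filter_upwards [Lp.coeFn_smul c q] with x hx
        rw [hx, Pi.smul_apply, map_smul, Pi.smul_apply] }
    (2 / γ) fun q => by
      refine Lp.norm_le_mul_norm_of_ae_le_mul ?_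
      filter_upwards [(memLp_fderiv_huberGrad hγ p q).coeFn_toLp] with x hx
      change ‖(memLp_fderiv_huberGrad hγ p q).toLp _ x‖ ≤ _
      rw [hx]
      exact ContinuousLinearMap.le_of_opNorm_le _ (norm_fderiv_huberGrad_le hγ _) _

theorem coeFn_huberHess (hγ : 0 < γ) (p q : L2v Ω) :
    huberHess Ω hγ p q =ᵐ[Ω.meas] fun x => fderiv ℝ (huberGrad γ) (p x) (q x) :=
  (memLp_fderiv_huberGrad hγ p q).coeFn_toLp

/-- For a fixed direction the difference quotients converge almost everywhere, because the kink is
avoided, and are dominated by a multiple of `‖q x‖`. Dominated convergence for the squared `L²`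
distance concludes. -/
theorem hasGateauxDerivAt_huberOp (hγ : 0 < γ) {p : L2v Ω} (hp : ∀ᵐ x ∂Ω.meas, ‖p x‖ ≠ γ) :
    HasGateauxDerivAt (huberOp Ω hγ) (huberHess Ω hγ p) p := by
  intro q
  rw [hasDerivAt_iff_tendsto_slope_zero, tendsto_iff_norm_sub_tendsto_zero]
  simp only [zero_add, zero_smul, add_zero]
  have hsq : Tendsto (fun t : ℝ => ‖t⁻¹ • (huberOp Ω hγ (p + t • q) - huberOp Ω hγ p)
      - huberHess Ω hγ p q‖ ^ 2) (𝓝[≠] 0) (𝓝 0) := by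
    have e : ∀ t : ℝ, ‖t⁻¹ • (huberOp Ω hγ (p + t • q) - huberOp Ω hγ p)
        - huberHess Ω hγ p q‖ ^ 2
        = ∫ x, ‖t⁻¹ • (huberGrad γ (p x + t • q x) - huberGrad γ (p x))
          - fderiv ℝ (huberGrad γ) (p x) (q x)‖ ^ 2 ∂Ω.meas := by
      intro t
      rw [Lp_norm_sq]
      refine integral_congr_ae ?_
      filter_upwards [Lp.coeFn_sub (t⁻¹ • (huberOp Ω hγ (p + t • q) - huberOp Ω hγ p))
          (huberHess Ω hγ p q), Lp.coeFn_smul t⁻¹ (huberOp Ω hγ (p + t • q) - huberOp Ω hγ p),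
        Lp.coeFn_sub (huberOp Ω hγ (p + t • q)) (huberOp Ω hγ p), coeFn_huberOp hγ (p + t • q),
        coeFn_huberOp hγ p, coeFn_huberHess hγ p q, Lp.coeFn_add p (t • q),
        Lp.coeFn_smul t q] with x h1 h2 h3 h4 h5 h6 h7 h8
      rw [h1, Pi.sub_apply, h2, Pi.smul_apply, h3, Pi.sub_apply, h4, h5, h6, h7, Pi.add_apply, h8,
        Pi.smul_apply]
    simp_rw [e]
    have hz : (0 : ℝ) = ∫ _x : E3, (0 : ℝ) ∂Ω.meas := integral_zero _ _ |>.symm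
    rw [show 𝓝 (0 : ℝ) = 𝓝 (∫ _x : E3, (0 : ℝ) ∂Ω.meas) by rw [← hz]]
    refine tendsto_integral_filter_of_dominated_convergence
      (fun x => (4 / γ) ^ 2 * ‖q x‖ ^ 2) (Eventually.of_forall fun t => ?_) ?_
      ((integrable_norm_sq q).const_mul _) ?_
    · have hh := continuous_huberGrad (E := E3) hγ
      have hp := Lp.aestronglyMeasurable p
      have hq := Lp.aestronglyMeasurable q
      exact (((((hh.comp_aestronglyMeasurable (hp.add (hq.const_smul t))).sub
        (hh.comp_aestronglyMeasurable hp)).const_smul t⁻¹).sub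
        (memLp_fderiv_huberGrad hγ p q).aestronglyMeasurable).norm.pow 2)
    · filter_upwards [self_mem_nhdsWithin] with t ht
      refine Eventually.of_forall fun x => ?_
      rw [norm_pow, norm_norm, ← mul_pow]
      refine pow_le_pow_left₀ (norm_nonneg _) ((norm_sub_le _ _).trans ?_) 2
      -- The quotient and the derivative are each at most `2/γ * ‖q x‖`, whence the dominating
      -- constant `4/γ`.
      have h1 := norm_huberGrad_sub_le hγ (p x + t • q x) (p x)
      have h2 := ContinuousLinearMap.le_of_opNorm_le _ (norm_fderiv_huberGrad_le hγ (p x)) (q x)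
      have h3 : ‖t⁻¹ • (huberGrad γ (p x + t • q x) - huberGrad γ (p x))‖ ≤ 2 / γ * ‖q x‖ := by
        rw [add_sub_cancel_left, norm_smul] at h1
        rw [norm_smul, norm_inv]
        have : 0 < ‖t‖ := norm_pos_iff.2 ht
        rw [inv_mul_le_iff₀ this]
        linarith
      calc _ ≤ 2 / γ * ‖q x‖ + 2 / γ * ‖q x‖ := add_le_add h3 h2
        _ = 4 / γ * ‖q x‖ := by ring
    · filter_upwards [hp] with x hx
      have hd := (differentiableAt_huberGrad hγ hx).hasFDerivAt.hasLineDerivAt (q x)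
      have := hd.tendsto_slope_zero
      have := (tendsto_iff_norm_sub_tendsto_zero.1 this).pow 2
      simpa using this
  have := hsq.sqrt
  simpa using this

theorem hasGateauxDerivAt_thetaGrad (hγ : 0 < γ) (ε : ℝ) {p : L2v Ω}
    (hp : ∀ᵐ x ∂Ω.meas, ‖p x‖ ≠ γ) :
    HasGateauxDerivAt (thetaGrad Ω hγ ε)
      (huberHess Ω hγ p + ε • ContinuousLinearMap.id ℝ (L2v Ω)) p := by
  intro q
  have h1 := hasGateauxDerivAt_huberOp hγ hp q
  have h2 : HasDerivAt (fun t : ℝ => ε • (p + t • q)) (ε • q) 0 := by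
    have := (((hasDerivAt_id (0 : ℝ)).smul_const q).const_add p).const_smul ε
    rwa [one_smul] at this
  exact h1.add h2

/-! ### Gateaux derivatives and the chain rule on finite-dimensional spaces -/

section Gateaux

variable {X Y : Type*} [NormedAddCommGroup X] [NormedSpace ℝ X]
  [NormedAddCommGroup Y] [NormedSpace ℝ Y]

theorem HasGateauxDerivAt.unique {f : X → Y} {A B : X →L[ℝ] Y} {x : X}
    (hA : HasGateauxDerivAt f A x) (hB : HasGateauxDerivAt f B x) : A = B :=
  ContinuousLinearMap.ext fun h => (hA h).unique (hB h)

theorem HasGateauxDerivAt.gateauxDeriv {f : X → Y} {A : X →L[ℝ] Y} {x : X}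
    (hA : HasGateauxDerivAt f A x) : HasGateauxDerivAt f (gateauxDeriv f x) x := by
  have h : ∃ A : X →L[ℝ] Y, HasGateauxDerivAt f A x := ⟨A, hA⟩
  rw [ICTVTV.gateauxDeriv, dif_pos h]
  exact h.choose_spec

/-- The chain rule for a Lipschitz Gateaux differentiable function and an inner function that is
Fréchet differentiable on a finite-dimensional space. -/
theorem HasGateauxDerivAt.comp_hasFDerivAt {E : Type*} [NormedAddCommGroup E] [NormedSpace ℝ E]
    [FiniteDimensional ℝ E] {f : X → Y} {A : X →L[ℝ] Y} {C : NNReal} (hf : LipschitzWith C f)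
    {p : E → X} {p' : E →L[ℝ] X} {e : E} (hA : HasGateauxDerivAt f A (p e))
    (hp : HasFDerivAt p p' e) : HasFDerivAt (fun b => f (p b)) (A.comp p') e := by
  have h1 : HasFDerivAt (fun b => f (p e + p' (b - e))) (A.comp p') e := by
    have hl : LipschitzWith (C * ‖p'‖₊) fun b => f (p e + p' (b - e)) := by
      refine hf.comp (LipschitzWith.of_dist_le_mul fun b c => ?_)
      rw [dist_add_left, dist_eq_norm, dist_eq_norm, ← map_sub, sub_sub_sub_cancel_right]
      exact p'.le_opNorm _
    -- On a finite-dimensional space, a Lipschitz map whose directional derivatives are given by a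
    -- linear map is Fréchet differentiable.
    refine hl.hasFDerivAt_of_hasLineDerivAt_of_closure (s := univ) (by simp) fun v _ => ?_
    have := hA (p' v)
    simpa [HasLineDerivAt] using this
  rw [hasFDerivAt_iff_isLittleO] at h1 hp ⊢
  -- Replacing `p` by its linearisation costs at most `C` times the remainder of `p`.
  have h2 : (fun b => f (p b) - f (p e + p' (b - e))) =o[𝓝 e] fun b => b - e := by
    refine Asymptotics.IsBigO.trans_isLittleO (g := fun b => p b - p e - p' (b - e)) ?_ hp
    refine Asymptotics.IsBigO.of_bound C (Eventually.of_forall fun b => ?_)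
    have := hf.dist_le_mul (p b) (p e + p' (b - e))
    rwa [dist_eq_norm, dist_eq_norm, ← sub_sub] at this
  refine (h2.add h1).congr_left fun b => ?_
  rw [sub_self, map_zero, add_zero]
  abel

end Gateaux

theorem hasGateauxDerivAt_gradient_theta (hγ : 0 < γ) (hε : 0 < ε) {p : L2v Ω}
    (hp : ∀ᵐ x ∂Ω.meas, ‖p x‖ ≠ γ) :
    HasGateauxDerivAt (gradient (Theta γ ε)) (gateauxDeriv (gradient (Theta γ ε)) p) p := by
  have := hasGateauxDerivAt_thetaGrad hγ ε hp
  rw [← gradient_theta hγ hε] at this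
  exact this.gateauxDeriv

/-- The Hessian of `Θ` is coercive. -/
theorem inner_gateauxDeriv_theta_ge (hγ : 0 < γ) (hε : 0 < ε) {p : L2v Ω}
    (hp : ∀ᵐ x ∂Ω.meas, ‖p x‖ ≠ γ) (q : L2v Ω) :
    ε * ‖q‖ ^ 2 ≤ inner ℝ (gateauxDeriv (gradient (Theta γ ε)) p q) q := by
  have h := (hasGateauxDerivAt_gradient_theta hγ hε hp q).tendsto_slope_zero
  have h' := h.inner (𝕜 := ℝ) (tendsto_const_nhds (x := q))
  refine ge_of_tendsto h' ?_
  filter_upwards [self_mem_nhdsWithin] with t ht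
  have ht : t ≠ 0 := ht
  -- Strong monotonicity between `p + t q` and `p`; dividing by `t²` gives the bound for the slope,
  -- which passes to the limit.
  have := inner_thetaGrad_sub_ge (ε := ε) hγ (p + t • q) p
  simp only [zero_add, zero_smul, add_zero, gradient_theta hγ hε]
  rw [add_sub_cancel_left, inner_smul_right, norm_smul, mul_pow, Real.norm_eq_abs, sq_abs] at this
  rw [real_inner_smul_left]
  have h2 : 0 < t ^ 2 := by positivity
  refine le_of_mul_le_mul_left ?_ h2
  calc t ^ 2 * (ε * ‖q‖ ^ 2) = ε * (t ^ 2 * ‖q‖ ^ 2) := by ring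
    _ ≤ _ := this
    _ = _ := by field_simp

end

section

/-! ### Averages of test functions along segments -/

/-- The uniform probability measure on the segment from `0` to `h`. -/
def segMeasure (h : E3) : Measure E3 :=
  (volume.restrict (Icc (0 : ℝ) 1)).map fun s : ℝ => s • h

theorem measurable_smul_vec (h : E3) : Measurable fun s : ℝ => s • h :=
  (continuous_id.smul continuous_const).measurable

instance (h : E3) : IsProbabilityMeasure (segMeasure h) := by
  have : IsProbabilityMeasure (volume.restrict (Icc (0 : ℝ) 1)) := ⟨by simp⟩
  exact Measure.isProbabilityMeasure_map (measurable_smul_vec h).aemeasurable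

/-- The average `x ↦ ∫₀¹ ψ(x - s h) ds`. -/
def segAvg (h : E3) (ψ : E3 → ℝ) (x : E3) : ℝ := ∫ t, ψ (x - t) ∂segMeasure h

theorem segAvg_eq (h : E3) {ψ : E3 → ℝ} (hψ : Continuous ψ) (x : E3) :
    segAvg h ψ x = ∫ s in (0 : ℝ)..1, ψ (x - s • h) := by
  rw [segAvg, segMeasure, integral_map (measurable_smul_vec h).aemeasurable
    (by fun_prop : Continuous fun t => ψ (x - t)).aestronglyMeasurable,
    integral_Icc_eq_integral_Ioc, intervalIntegral.integral_of_le zero_le_one]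

/-- Smoothness of the average then comes from that of convolutions with a smooth, compactly
supported factor. -/
theorem segAvg_eq_convolution (h : E3) (ψ : E3 → ℝ) :
    segAvg h ψ = convolution (fun _ => (1 : ℝ)) ψ (ContinuousLinearMap.mul ℝ ℝ) (segMeasure h) := by
  ext x
  simp [segAvg, convolution]

theorem contDiff_segAvg (h : E3) {ψ : E3 → ℝ} (hψ : ContDiff ℝ (⊤ : ℕ∞) ψ)
    (hc : HasCompactSupport ψ) : ContDiff ℝ (⊤ : ℕ∞) (segAvg h ψ) := by
  rw [segAvg_eq_convolution]
  exact hc.contDiff_convolution_right _ (integrable_const _).locallyIntegrable hψ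

theorem fderiv_segAvg (h : E3) {ψ : E3 → ℝ} (hψ : ContDiff ℝ (⊤ : ℕ∞) ψ)
    (hc : HasCompactSupport ψ) (x : E3) : fderiv ℝ (segAvg h ψ) x h = ψ x - ψ (x - h) := by
  have hF : HasDerivAt (fun τ : ℝ => segAvg h ψ (x + τ • h)) (fderiv ℝ (segAvg h ψ) x h) 0 := by
    have := (((contDiff_segAvg h hψ hc).differentiable (by simp)) x).hasFDerivAt.hasLineDerivAt h
    exact this
  have hG : HasDerivAt (fun τ : ℝ => segAvg h ψ (x + τ • h)) (ψ x - ψ (x - h)) 0 := by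
    -- Moving `x` by `τ h` only shifts the integration interval to `[-τ, 1 - τ]`, so the fundamental
    -- theorem of calculus gives the derivative from the endpoints.
    have e : (fun τ : ℝ => segAvg h ψ (x + τ • h))
        = fun τ : ℝ => (∫ r in (0 : ℝ)..(1 - τ), ψ (x - r • h))
          - ∫ r in (0 : ℝ)..(-τ), ψ (x - r • h) := by
      ext τ
      have hi : ∀ a b, IntervalIntegrable (fun r : ℝ => ψ (x - r • h)) volume a b := fun a b =>
        (hψ.continuous.comp (by fun_prop)).intervalIntegrable a b
      rw [segAvg_eq h hψ.continuous, intervalIntegral.integral_interval_sub_left (hi _ _) (hi _ _)]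
      have := intervalIntegral.integral_comp_sub_right (a := 0) (b := 1)
        (fun r : ℝ => ψ (x - r • h)) τ
      rw [zero_sub] at this
      rw [← this]
      refine intervalIntegral.integral_congr fun s _ => ?_
      beta_reduce
      congr 1
      rw [sub_smul]
      abel
    rw [e]
    have hcont : Continuous fun r : ℝ => ψ (x - r • h) := hψ.continuous.comp (by fun_prop)
    have h1 := hcont.integral_hasStrictDerivAt 0 1 |>.hasDerivAt
    have h2 := hcont.integral_hasStrictDerivAt 0 0 |>.hasDerivAt
    have h1' := HasDerivAt.comp (h₂ := fun u => ∫ r in (0 : ℝ)..u, ψ (x - r • h))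
      (h := fun τ : ℝ => 1 - τ) (0 : ℝ) (by simpa using h1) ((hasDerivAt_id (0 : ℝ)).const_sub 1)
    have h2' := HasDerivAt.comp (h₂ := fun u => ∫ r in (0 : ℝ)..u, ψ (x - r • h))
      (h := fun τ : ℝ => -τ) (0 : ℝ) (by simpa using h2) (hasDerivAt_id (0 : ℝ)).neg
    rw [show ψ x - ψ (x - h) = ψ (x - h) * -1 - ψ x * -1 by ring]
    exact h1'.sub h2'
  exact hF.unique hG

/-- Jensen for the probability measure `segMeasure h`, then Tonelli and translation invariance. -/
theorem lintegral_segAvg_sq_le (h : E3) {ψ : E3 → ℝ} (hψ : Continuous ψ) :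
    ∫⁻ x, ‖segAvg h ψ x‖ₑ ^ 2 ≤ ∫⁻ x, ‖ψ x‖ₑ ^ 2 := by
  have h1 : ∀ x, ‖segAvg h ψ x‖ₑ ^ 2 ≤ ∫⁻ t, ‖ψ (x - t)‖ₑ ^ 2 ∂segMeasure h := by
    intro x
    have hm : AEStronglyMeasurable (fun t => ψ (x - t)) (segMeasure h) :=
      (by fun_prop : Continuous fun t => ψ (x - t)).aestronglyMeasurable
    have := eLpNorm_le_eLpNorm_of_exponent_le (p := 1) (q := 2) (by norm_num) hm
    rw [eLpNorm_one_eq_lintegral_enorm,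
      eLpNorm_eq_lintegral_rpow_enorm_toReal (by norm_num) (by norm_num)] at this
    have h2 := (enorm_integral_le_lintegral_enorm (μ := segMeasure h)
      fun t => ψ (x - t)).trans this
    calc ‖segAvg h ψ x‖ₑ ^ 2 ≤ _ := pow_le_pow_left' h2 2
      _ = _ := by
        rw [← ENNReal.rpow_natCast, ← ENNReal.rpow_mul]
        norm_num
  refine (lintegral_mono h1).trans ?_
  rw [lintegral_lintegral_swap]
  · have : ∀ t : E3, ∫⁻ x, ‖ψ (x - t)‖ₑ ^ 2 = ∫⁻ x, ‖ψ x‖ₑ ^ 2 := fun t =>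
      lintegral_sub_right_eq_self (fun x => ‖ψ x‖ₑ ^ 2) t
    simp [this]
  · exact (Continuous.measurable (by fun_prop)).aemeasurable

theorem tsupport_segAvg_subset {h : E3} {ψ : E3 → ℝ} (hψ : Continuous ψ)
    (hc : HasCompactSupport ψ) {W : Set E3}
    (hW : ∀ x ∈ tsupport ψ, ∀ s ∈ Icc (0 : ℝ) 1, x + s • h ∈ W) :
    HasCompactSupport (segAvg h ψ) ∧ tsupport (segAvg h ψ) ⊆ W := by
  set K : Set E3 := image (fun z : E3 × ℝ => z.1 + z.2 • h) (tsupport ψ ×ˢ Icc (0 : ℝ) 1) with hK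
  have hKc : IsCompact K := (hc.isCompact.prod isCompact_Icc).image (by fun_prop)
  have hz : ∀ x ∉ K, segAvg h ψ x = 0 := by
    intro x hx
    rw [segAvg_eq h hψ, intervalIntegral.integral_congr (g := fun _ => (0 : ℝ))]
    · simp
    · intro s hs
      rw [uIcc_of_le zero_le_one] at hs
      refine image_eq_zero_of_notMem_tsupport fun hmem => hx ?_
      exact ⟨(x - s • h, s), ⟨hmem, hs⟩, by simp⟩
  refine ⟨HasCompactSupport.intro hKc hz, ?_⟩
  refine (closure_minimal (fun x hx => ?_) hKc.isClosed : _ ⊆ K).trans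
    (fun x hx => ?_)
  · by_contra hxK
    exact hx (hz x hxK)
  · obtain ⟨⟨y, s⟩, ⟨hy, hs⟩, rfl⟩ := hx
    exact hW y hy s hs

end

section

/-! ### Difference quotients of Sobolev functions -/

/-- Test functions are dense in `L²`, in the form: a norm bound tested against them. -/
theorem norm_le_of_forall_test {U : Set E3} (hU : IsOpen U) (D : Lp ℝ 2 (volume.restrict U))
    {C : ℝ} (hC : 0 ≤ C)
    (h : ∀ ψ : E3 → ℝ, ContDiff ℝ (⊤ : ℕ∞) ψ → HasCompactSupport ψ → tsupport ψ ⊆ U →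
      ∀ q : Lp ℝ 2 (volume.restrict U), q =ᵐ[volume.restrict U] ψ → inner ℝ D q ≤ C * ‖q‖) :
    ‖D‖ ≤ C := by
  let K : Submodule ℝ (Lp ℝ 2 (volume.restrict U)) :=
    { carrier := {q | ∃ ψ : E3 → ℝ, ContDiff ℝ (⊤ : ℕ∞) ψ ∧ HasCompactSupport ψ ∧
        tsupport ψ ⊆ U ∧ q =ᵐ[volume.restrict U] ψ}
      zero_mem' := ⟨0, contDiff_const, HasCompactSupport.zero, by simp [tsupport],
        Lp.coeFn_zero _ _ _⟩
      add_mem' := by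
        rintro p q ⟨φ, h1, h2, h3, h4⟩ ⟨ψ, h1', h2', h3', h4'⟩
        exact ⟨φ + ψ, h1.add h1', h2.add h2',
          (tsupport_add φ ψ).trans (union_subset h3 h3'), (Lp.coeFn_add p q).trans (h4.add h4')⟩
      smul_mem' := by
        rintro c q ⟨ψ, h1', h2', h3', h4'⟩
        exact ⟨c • ψ, contDiff_const.smul h1', h2'.smul_left (f := fun _ => c),
          (tsupport_smul_subset_right (fun _ => c) ψ).trans h3',
          (Lp.coeFn_smul c q).trans (h4'.const_smul c)⟩ }
  have hK : K.topologicalClosure = ⊤ := by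
    rw [Submodule.topologicalClosure_eq_top_iff, Submodule.eq_bot_iff]
    intro d hd
    have hloc : LocallyIntegrableOn d U volume :=
      locallyIntegrableOn_of_locallyIntegrable_restrict
        ((Lp.memLp d).locallyIntegrable (by norm_num))
    -- The orthogonal complement of the test functions is trivial by the fundamental lemma of the
    -- calculus of variations.
    have := hU.ae_eq_zero_of_integral_contDiff_smul_eq_zero hloc fun ψ h1 h2 h3 => by
      have hm : MemLp ψ 2 (volume.restrict U) := h1.continuous.memLp_of_hasCompactSupport h2
      have hq := hd (hm.toLp ψ) ⟨ψ, h1, h2, h3, hm.coeFn_toLp⟩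
      rw [L2.inner_def] at hq
      rw [← setIntegral_eq_integral_of_forall_compl_eq_zero (s := U), ← hq]
      · refine integral_congr_ae ?_
        filter_upwards [hm.coeFn_toLp] with x hx
        rw [hx]
        simp [mul_comm]
      · intro x hx
        rw [image_eq_zero_of_notMem_tsupport fun hmem => hx (h3 hmem), zero_smul]
    refine Lp.ext ?_
    filter_upwards [Lp.coeFn_zero ℝ 2 (volume.restrict U),
      (ae_restrict_iff' hU.measurableSet).2 this] with x h1 h2
    rw [h1, h2]
    rfl
  have hall : ∀ q : Lp ℝ 2 (volume.restrict U), inner ℝ D q ≤ C * ‖q‖ := by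
    intro q
    have hq : q ∈ K.topologicalClosure := hK ▸ Submodule.mem_top
    have hcl : IsClosed {q : Lp ℝ 2 (volume.restrict U) | inner ℝ D q ≤ C * ‖q‖} :=
      isClosed_le (by fun_prop) (by fun_prop)
    refine closure_minimal ?_ hcl hq
    rintro p ⟨ψ, h1, h2, h3, h4⟩
    exact h ψ h1 h2 h3 p h4
  have hD := hall D
  rw [real_inner_self_eq_norm_sq] at hD
  rcases (norm_nonneg D).eq_or_lt with h0 | h0
  · rwa [← h0]
  · nlinarith

variable {Ω : Domain}

theorem isWeakGrad_grad (z : H1 Ω) : IsWeakGrad Ω (toL2 Ω z) (grad Ω z) :=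
  (show H1sub Ω from z).2

/-- The definition of the weak gradient, tested in an arbitrary direction. -/
theorem integral_mul_fderiv (z : H1 Ω) {φ : E3 → ℝ} (hφ : ContDiff ℝ (⊤ : ℕ∞) φ)
    (hc : HasCompactSupport φ) (hs : tsupport φ ⊆ Ω.carrier) (e : E3) :
    ∫ x, toL2 Ω z x * fderiv ℝ φ x e ∂Ω.meas = - ∫ x, inner ℝ e (grad Ω z x) * φ x ∂Ω.meas := by
  have he : ∀ L : E3 →L[ℝ] ℝ, L e = ∑ i, e i * L (EuclideanSpace.single i 1) := by
    intro L
    conv_lhs => rw [← (EuclideanSpace.basisFun (Fin 3) ℝ).sum_repr e]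
    simp
  have h1 : ∀ x, toL2 Ω z x * fderiv ℝ φ x e
      = ∑ i, e i * (toL2 Ω z x * fderiv ℝ φ x (EuclideanSpace.single i 1)) := by
    intro x
    rw [he, Finset.mul_sum]
    exact Finset.sum_congr rfl fun i _ => by ring
  have h2 : ∀ x, inner ℝ e (grad Ω z x) * φ x = ∑ i, e i * (grad Ω z x i * φ x) := by
    intro x
    rw [PiLp.inner_apply, Finset.sum_mul]
    exact Finset.sum_congr rfl fun i _ => by simp; ring
  simp_rw [h1, h2]
  rw [integral_finsetSum _ fun i _ => (integrable_aux₁ _ φ hφ hc _).const_mul _,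
    integral_finsetSum _ fun i _ => (integrable_aux₂ _ φ hφ hc i).const_mul _,
    ← Finset.sum_neg_distrib]
  refine Finset.sum_congr rfl fun i _ => ?_
  rw [integral_const_mul, integral_const_mul, isWeakGrad_grad z φ hφ hc hs i]
  ring

/-- The extension of a Sobolev function by zero. -/
def extend (z : H1 Ω) : E3 → ℝ := Ω.carrier.indicator (toL2 Ω z)

theorem memLp_extend (z : H1 Ω) : MemLp (extend z) 2 volume :=
  (memLp_indicator_iff_restrict Ω.isOpen.measurableSet).2 (Lp.memLp _)

/-- The points that stay in the domain when translated along `[0, 1] h`. -/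
def shiftable (Ω : Domain) (h : E3) : Set E3 := {x | ∀ s ∈ Icc (0 : ℝ) 1, x + s • h ∈ Ω.carrier}

/-- Tube lemma: `[0, 1]` is compact and the domain is open. -/
theorem isOpen_shiftable (h : E3) : IsOpen (shiftable Ω h) := by
  rw [isOpen_iff_mem_nhds]
  intro x hx
  refine isCompact_Icc.eventually_forall_of_forall_eventually fun s hs => ?_
  have : Continuous fun z : E3 × ℝ => z.1 + z.2 • h := by fun_prop
  exact this.continuousAt.eventually (Ω.isOpen.mem_nhds (hx s hs))

/-- The translation inequality for Sobolev functions. -/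
theorem lintegral_sub_shift_le (z : H1 Ω) (h : E3) :
    ∫⁻ x in shiftable Ω h, ‖extend z (x + h) - extend z x‖ₑ ^ 2
      ≤ ENNReal.ofReal ((‖h‖ * ‖grad Ω z‖) ^ 2) := by
  set U := shiftable Ω h with hUdef
  have hU : IsOpen U := isOpen_shiftable h
  have hw := memLp_extend z
  have hwh : MemLp (fun x => extend z (x + h)) 2 volume :=
    hw.comp_measurePreserving (measurePreserving_add_right volume h)
  have hm : MemLp (fun x => extend z (x + h) - extend z x) 2 (volume.restrict U) :=
    (hwh.sub hw).restrict U
  have hD : ‖hm.toLp _‖ ≤ ‖h‖ * ‖grad Ω z‖ := by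
    refine norm_le_of_forall_test hU _ (by positivity) fun ψ h1 h2 h3 q hq => ?_
    -- Duality: the average of `ψ` is an admissible test function, and its derivative along `h` is
    -- `ψ - ψ(· - h)`. The weak gradient identity thus turns the pairing of the difference of `z`
    -- with `ψ` into that of `h · ∇z` with the average, whose norm does not exceed that of `ψ`.
    obtain ⟨hc, hs⟩ := tsupport_segAvg_subset (h := h) h1.continuous h2
      (W := Ω.carrier) fun x hx => h3 hx
    have hφ := contDiff_segAvg h h1 h2
    have e1 := integral_mul_fderiv z hφ hc hs h
    simp_rw [fderiv_segAvg h h1 h2] at e1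
    have e2 : inner ℝ (hm.toLp _) q = ∫ x, (extend z (x + h) - extend z x) * ψ x := by
      rw [L2.inner_def]
      refine Eq.trans ?_ (setIntegral_eq_integral_of_forall_compl_eq_zero (s := U) ?_)
      · refine integral_congr_ae ?_
        filter_upwards [hq, hm.coeFn_toLp] with x h4 h5
        rw [h4, h5]
        simp [mul_comm]
      · intro x hx
        rw [image_eq_zero_of_notMem_tsupport fun hmem => hx (h3 hmem), mul_zero]
    have hψ2 : MemLp ψ 2 volume := h1.continuous.memLp_of_hasCompactSupport h2
    have hψ2h : MemLp (fun x => ψ (x - h)) 2 volume :=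
      hψ2.comp_measurePreserving (measurePreserving_sub_right volume h)
    have e3 : ∫ x, toL2 Ω z x * (ψ x - ψ (x - h)) ∂Ω.meas
        = - ∫ x, (extend z (x + h) - extend z x) * ψ x := by
      have i1 : Integrable fun x => extend z x * ψ x := hw.integrable_mul hψ2
      have i2 : Integrable fun x => extend z x * ψ (x - h) := hw.integrable_mul hψ2h
      have i3 : Integrable fun x => extend z (x + h) * ψ x := hwh.integrable_mul hψ2
      have e4 : ∫ x, extend z x * ψ (x - h) = ∫ x, extend z (x + h) * ψ x := by
        rw [← integral_add_right_eq_self (fun x => extend z x * ψ (x - h)) h]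
        simp
      simp_rw [sub_mul]
      rw [integral_sub i3 i1, ← e4, neg_sub, ← integral_sub i1 i2,
        ← integral_indicator Ω.isOpen.measurableSet]
      refine integral_congr_ae (Eventually.of_forall fun x => ?_)
      by_cases hx : x ∈ Ω.carrier <;> simp [extend, hx, mul_sub]
    have hφ2 : MemLp (segAvg h ψ) 2 Ω.meas := hφ.continuous.memLp_of_hasCompactSupport hc
    have e5 : inner ℝ ((innerSL ℝ h).compLp (grad Ω z)) (hφ2.toLp _)
        = ∫ x, inner ℝ h (grad Ω z x) * segAvg h ψ x ∂Ω.meas := by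
      rw [L2.inner_def]
      refine integral_congr_ae ?_
      filter_upwards [hφ2.coeFn_toLp, (innerSL ℝ h).coeFn_compLp (grad Ω z)] with x h4 h5
      rw [h4, h5]
      simp [mul_comm]
    have e6 : inner ℝ (hm.toLp _) q = inner ℝ ((innerSL ℝ h).compLp (grad Ω z)) (hφ2.toLp _) := by
      rw [e2, e5]
      linarith
    have e7 : ‖hφ2.toLp _‖ ≤ ‖q‖ := by
      refine le_of_sq_le_sq ?_ (norm_nonneg _)
      rw [← ENNReal.ofReal_le_ofReal_iff (sq_nonneg _), ← lintegral_enorm_sq, ← lintegral_enorm_sq]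
      calc ∫⁻ x, ‖hφ2.toLp _ x‖ₑ ^ 2 ∂Ω.meas = ∫⁻ x, ‖segAvg h ψ x‖ₑ ^ 2 ∂Ω.meas := by
            refine lintegral_congr_ae ?_
            filter_upwards [hφ2.coeFn_toLp] with x h4
            rw [h4]
        _ ≤ ∫⁻ x, ‖segAvg h ψ x‖ₑ ^ 2 := setLIntegral_le_lintegral _ _
        _ ≤ ∫⁻ x, ‖ψ x‖ₑ ^ 2 := lintegral_segAvg_sq_le h h1.continuous
        _ = ∫⁻ x in U, ‖ψ x‖ₑ ^ 2 := by
            rw [← lintegral_indicator hU.measurableSet]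
            refine lintegral_congr fun x => ?_
            by_cases hx : x ∈ U
            · simp [hx]
            · simp [hx, image_eq_zero_of_notMem_tsupport fun hmem => hx (h3 hmem)]
        _ = ∫⁻ x in U, ‖q x‖ₑ ^ 2 := by
            refine lintegral_congr_ae ?_
            filter_upwards [hq] with x h4
            rw [h4]
    have e8 : ‖(innerSL ℝ h).compLp (grad Ω z)‖ ≤ ‖h‖ * ‖grad Ω z‖ := by
      have := (innerSL ℝ h).norm_compLp_le (grad Ω z)
      rwa [innerSL_apply_norm] at this
    rw [e6]
    exact (real_inner_le_norm _ _).trans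
      (mul_le_mul e8 e7 (norm_nonneg _) (by positivity))
  calc _ = ∫⁻ x in U, ‖hm.toLp _ x‖ₑ ^ 2 := by
        refine lintegral_congr_ae ?_
        filter_upwards [hm.coeFn_toLp] with x hx
        rw [hx]
    _ ≤ _ := by
        rw [lintegral_enorm_sq]
        exact ENNReal.ofReal_le_ofReal (pow_le_pow_left₀ (norm_nonneg _) hD 2)

end

section

/-! ### The Poincaré inequality -/

variable {Ω : Domain}

theorem measurable_extend (z : H1 Ω) : Measurable (extend z) :=
  (Lp.stronglyMeasurable _).measurable.indicator Ω.isOpen.measurableSet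

/-- The squared `L²` norm over `A`. -/
def mass (z : H1 Ω) (A : Set E3) : ENNReal := ∫⁻ x in A, ‖extend z x‖ₑ ^ 2

theorem mass_mono (z : H1 Ω) {A B : Set E3} (h : A ⊆ B) : mass z A ≤ mass z B :=
  lintegral_mono_set h

theorem mass_union_le (z : H1 Ω) (A B : Set E3) : mass z (A ∪ B) ≤ mass z A + mass z B :=
  lintegral_union_le _ _ _

theorem enorm_sq_le_two_mul (a b : ℝ) : ‖a‖ₑ ^ 2 ≤ 2 * ‖b‖ₑ ^ 2 + 2 * ‖b - a‖ₑ ^ 2 := by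
  have h : ∀ c : ℝ, ‖c‖ₑ ^ 2 = ENNReal.ofReal (c ^ 2) := fun c => by
    rw [← ofReal_norm, ← ENNReal.ofReal_pow (norm_nonneg c), Real.norm_eq_abs, sq_abs]
  rw [h, h, h, ← ENNReal.ofReal_ofNat 2, ← ENNReal.ofReal_mul (by norm_num),
    ← ENNReal.ofReal_mul (by norm_num), ← ENNReal.ofReal_add (by positivity) (by positivity)]
  exact ENNReal.ofReal_le_ofReal (by nlinarith [sq_nonneg (2 * b - a)])

theorem mass_le_shift (z : H1 Ω) {h : E3} {A A' : Set E3} (hA : A ⊆ shiftable Ω h)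
    (hA' : ∀ x ∈ A, x + h ∈ A') :
    mass z A ≤ 2 * mass z A' + 2 * ENNReal.ofReal ((‖h‖ * ‖grad Ω z‖) ^ 2) := by
  have hmp := measurePreserving_add_right (volume : Measure E3) h
  have hm := measurable_extend z
  calc mass z A ≤ ∫⁻ x in A, (2 * ‖extend z (x + h)‖ₑ ^ 2
        + 2 * ‖extend z (x + h) - extend z x‖ₑ ^ 2) :=
        lintegral_mono fun x => enorm_sq_le_two_mul _ _
    _ = 2 * (∫⁻ x in A, ‖extend z (x + h)‖ₑ ^ 2)
        + 2 * ∫⁻ x in A, ‖extend z (x + h) - extend z x‖ₑ ^ 2 := by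
      rw [lintegral_add_left (by fun_prop), lintegral_const_mul _ (by fun_prop),
        lintegral_const_mul _ (by fun_prop)]
    _ ≤ _ := by
      refine add_le_add (mul_le_mul_right ?_ 2) (mul_le_mul_right ?_ 2)
      · exact (lintegral_mono_set hA').trans (hmp.setLIntegral_comp_preimage_emb
          (measurableEmbedding_addRight h) (fun x => ‖extend z x‖ₑ ^ 2) A').le
      · exact (lintegral_mono_set hA).trans (lintegral_sub_shift_le z h)

/-- The mass over `A` is controlled by the mass over `B` and the norm of the gradient. -/
def Controlled (Ω : Domain) (B A : Set E3) : Prop :=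
  ∃ C : NNReal, ∀ z : H1 Ω, mass z A ≤ C * (mass z B + ENNReal.ofReal (‖grad Ω z‖ ^ 2))

theorem Controlled.mono {B A A' : Set E3} (h : Controlled Ω B A) (hA : A' ⊆ A) :
    Controlled Ω B A' :=
  let ⟨C, hC⟩ := h
  ⟨C, fun z => (mass_mono z hA).trans (hC z)⟩

theorem controlled_self (B : Set E3) : Controlled Ω B B :=
  ⟨1, fun z => by simp⟩

theorem controlled_empty (B : Set E3) : Controlled Ω B ∅ :=
  ⟨0, fun z => by simp [mass]⟩

theorem Controlled.union {B A A' : Set E3} (h : Controlled Ω B A) (h' : Controlled Ω B A') :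
    Controlled Ω B (A ∪ A') := by
  obtain ⟨C, hC⟩ := h
  obtain ⟨C', hC'⟩ := h'
  refine ⟨C + C', fun z => (mass_union_le z A A').trans ?_⟩
  rw [ENNReal.coe_add, add_mul]
  exact add_le_add (hC z) (hC' z)

theorem Controlled.shift {B A A' : Set E3} {h : E3} (hc : Controlled Ω B A')
    (hA : A ⊆ shiftable Ω h) (hA' : ∀ x ∈ A, x + h ∈ A') : Controlled Ω B A := by
  obtain ⟨C, hC⟩ := hc
  refine ⟨2 * C + 2 * ‖h‖₊ ^ 2, fun z => (mass_le_shift z hA hA').trans ?_⟩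
  rw [mul_pow, ENNReal.ofReal_mul (by positivity), ENNReal.ofReal_pow (norm_nonneg h),
    ofReal_norm, ENNReal.coe_add, add_mul]
  refine add_le_add ?_ ?_
  · rw [ENNReal.coe_mul, mul_assoc]
    exact mul_le_mul_right (hC z) _
  · rw [ENNReal.coe_mul, ENNReal.coe_pow, ← mul_assoc]
    exact mul_le_mul_right le_add_self _

theorem mem_shiftable_of_mem_ball {y : E3} {r : ℝ} (hy : Metric.ball y r ⊆ Ω.carrier) {x h : E3}
    (hx : x ∈ Metric.ball y r) (hxh : x + h ∈ Metric.ball y r) : x ∈ shiftable Ω h := by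
  intro s hs
  refine hy ?_
  have := (convex_ball y r).add_smul_sub_mem hx hxh hs
  rwa [add_sub_cancel_left] at this

/-- The set of points with a controlled ball is open, contains `x₀` and is relatively closed in the
domain, so connectedness makes it contain the whole domain. -/
theorem controlled_ball {x₀ : E3} {r₀ : ℝ} (hr₀ : 0 < r₀) (h₀ : x₀ ∈ Ω.carrier) {x : E3}
    (hx : x ∈ Ω.carrier) : ∃ r > 0, Controlled Ω (Metric.ball x₀ r₀) (Metric.ball x r) := by
  set G : Set E3 := {x | ∃ r > 0, Controlled Ω (Metric.ball x₀ r₀) (Metric.ball x r)} with hG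
  have hopen : IsOpen G := by
    rw [Metric.isOpen_iff]
    rintro y ⟨r, hr, hc⟩
    refine ⟨r, hr, fun w hw => ⟨r - dist w y, sub_pos.2 hw, hc.mono ?_⟩⟩
    exact Metric.ball_subset_ball' (by linarith)
  have := Ω.isConnected.isPreconnected.subset_of_closure_inter_subset hopen
    ⟨x₀, h₀, r₀, hr₀, controlled_self _⟩ ?_
  · exact this hx
  · rintro y ⟨hy, hyΩ⟩
    obtain ⟨δ, hδ, hball⟩ := Metric.isOpen_iff.1 Ω.isOpen y hyΩ
    obtain ⟨w, ⟨r, hr, hc⟩, hyw⟩ := Metric.mem_closure_iff.1 hy (δ / 2) (by positivity)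
    -- Translation by `w - y` carries a small ball about `y` into the controlled ball about `w`; the
    -- radius keeps both ends in the convex ball of radius `δ` about `y`, hence every segment as
    -- well.
    refine ⟨min r (δ / 2), by positivity, hc.shift (h := w - y) (fun v hv => ?_) fun v hv => ?_⟩
    · have hv' := Metric.mem_ball.1 hv
      have h1 := min_le_right r (δ / 2)
      refine mem_shiftable_of_mem_ball hball (Metric.mem_ball.2 (by linarith)) ?_
      rw [Metric.mem_ball, dist_eq_norm]
      calc ‖v + (w - y) - y‖ = ‖(v - y) + (w - y)‖ := by congr 1; abel
        _ ≤ ‖v - y‖ + ‖w - y‖ := norm_add_le _ _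
        _ < δ := by
          rw [← dist_eq_norm, ← dist_eq_norm, dist_comm w y]
          linarith
    · have hv' := Metric.mem_ball.1 hv
      rw [Metric.mem_ball, dist_eq_norm]
      rw [dist_eq_norm] at hv'
      calc ‖v + (w - y) - w‖ = ‖v - y‖ := by congr 1; abel
        _ < r := hv'.trans_le (min_le_left _ _)

theorem controlled_of_isCompact {x₀ : E3} {r₀ : ℝ} (hr₀ : 0 < r₀) (h₀ : x₀ ∈ Ω.carrier)
    {K : Set E3} (hK : IsCompact K) (hKΩ : K ⊆ Ω.carrier) :
    Controlled Ω (Metric.ball x₀ r₀) K := by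
  refine hK.induction_on (controlled_empty _) (fun s t hst ht => ht.mono hst)
    (fun s t hs ht => hs.union ht) fun x hx => ?_
  obtain ⟨r, hr, hc⟩ := controlled_ball hr₀ h₀ (hKΩ hx)
  exact ⟨_, mem_nhdsWithin_of_mem_nhds (Metric.ball_mem_nhds x hr), hc⟩

theorem controlled_domain {x₀ : E3} {r₀ : ℝ} (hr₀ : 0 < r₀) (h₀ : x₀ ∈ Ω.carrier) :
    Controlled Ω (Metric.ball x₀ r₀) Ω.carrier := by
  have hcomp : IsCompact (closure Ω.carrier) := Ω.isBounded.isCompact_closure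
  suffices h : Controlled Ω (Metric.ball x₀ r₀) (closure Ω.carrier ∩ Ω.carrier) from
    h.mono fun x hx => ⟨subset_closure hx, hx⟩
  refine hcomp.induction_on (p := fun s => Controlled Ω (Metric.ball x₀ r₀) (s ∩ Ω.carrier))
    (by simpa using controlled_empty _)
    (fun s t hst ht => ht.mono (inter_subset_inter_left _ hst))
    (fun s t hs ht => (union_inter_distrib_right s t _) ▸ hs.union ht) fun x hx => ?_
  by_cases hxΩ : x ∈ Ω.carrier
  · obtain ⟨r, hr, hc⟩ := controlled_ball hr₀ h₀ hxΩ
    exact ⟨_, mem_nhdsWithin_of_mem_nhds (Metric.ball_mem_nhds x hr), hc.mono inter_subset_left⟩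
  · have hfr : x ∈ frontier Ω.carrier := ⟨hx, fun h => hxΩ (interior_subset h)⟩
    -- The only use of boundary regularity: half the segment vector pushes the closed domain near
    -- `x` onto a compact subset of the open domain, which is already controlled.
    obtain ⟨U, hU, e, he⟩ := Ω.segment x hfr
    obtain ⟨r, hr, hrU⟩ := Metric.nhds_basis_closedBall.mem_iff.1 hU
    refine ⟨Metric.closedBall x r,
      mem_nhdsWithin_of_mem_nhds (Metric.closedBall_mem_nhds x hr), ?_⟩
    have hK : IsCompact (image (fun y : E3 => y + (1 / 2 : ℝ) • e)
        (closure Ω.carrier ∩ Metric.closedBall x r)) :=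
      (hcomp.inter_right Metric.isClosed_closedBall).image (by fun_prop)
    have hKΩ : image (fun y : E3 => y + (1 / 2 : ℝ) • e)
        (closure Ω.carrier ∩ Metric.closedBall x r) ⊆ Ω.carrier := by
      rintro _ ⟨y, ⟨hy1, hy2⟩, rfl⟩
      exact he y ⟨hy1, hrU hy2⟩ _ (by norm_num)
    refine (controlled_of_isCompact hr₀ h₀ hK hKΩ).shift (h := (1 / 2 : ℝ) • e) ?_ ?_
    · rintro y ⟨hy1, hy2⟩ s ⟨hs0, hs1⟩
      -- The segment property excludes the endpoint `s = 0`, where membership in the domain is known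
      -- directly.
      rcases hs0.eq_or_lt with rfl | hs0
      · simpa using hy2
      · rw [smul_smul]
        exact he y ⟨subset_closure hy2, hrU hy1⟩ _ ⟨by positivity, by linarith⟩
    · rintro y ⟨hy1, hy2⟩
      exact ⟨y, ⟨subset_closure hy2, hy1⟩, rfl⟩

/-- The constant function `1` in `H¹(Ω)`. -/
def oneH1 (Ω : Domain) : H1 Ω :=
  ⟨WithLp.toLp 2 (cOne Ω, 0), by
    intro φ hφ hc hs i
    have hd : Continuous fun x => fderiv ℝ φ x (EuclideanSpace.single i (1 : ℝ)) :=
      (hφ.continuous_fderiv (by simp)).clm_apply continuous_const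
    have h1 : ∫ x, cOne Ω x * fderiv ℝ φ x (EuclideanSpace.single i 1) ∂Ω.meas
        = ∫ x, (1 : ℝ) * fderiv ℝ φ x (EuclideanSpace.single i 1) := by
      refine Eq.trans ?_ (setIntegral_eq_integral_of_forall_compl_eq_zero (s := Ω.carrier) ?_)
      · refine integral_congr_ae ?_
        filter_upwards [(memLp_const (1 : ℝ) (μ := Ω.meas) (p := 2)).coeFn_toLp] with x hx
        rw [cOne, hx]
      · intro x hx
        have : x ∉ tsupport (fderiv ℝ φ) := fun h => hx (hs (tsupport_fderiv_subset ℝ h))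
        rw [image_eq_zero_of_notMem_tsupport this]
        simp
    have h2 : ∫ x, (0 : L2v Ω) x i * φ x ∂Ω.meas = 0 := by
      apply integral_eq_zero_of_ae
      filter_upwards [Lp.coeFn_zero E3 2 Ω.meas] with x hx
      rw [hx]
      simp
    change ∫ x, cOne Ω x * fderiv ℝ φ x (EuclideanSpace.single i 1) ∂Ω.meas
      = - ∫ x, (0 : L2v Ω) x i * φ x ∂Ω.meas
    rw [h1, h2, integral_mul_fderiv_eq_neg_fderiv_mul_of_integrable]
    · simp
    · simp
    · simpa using hd.integrable_of_hasCompactSupport (hc.fderiv_apply (𝕜 := ℝ) _)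
    · simpa using hφ.continuous.integrable_of_hasCompactSupport hc
    · exact fun x _ => differentiableAt_const _
    · exact fun x _ => hφ.differentiable (by simp) x⟩

theorem toL2_oneH1 : toL2 Ω (oneH1 Ω) = cOne Ω := rfl

theorem grad_oneH1 : grad Ω (oneH1 Ω) = 0 := rfl

theorem coeFn_cOne : cOne Ω =ᵐ[Ω.meas] fun _ => 1 := (memLp_const (1 : ℝ)).coeFn_toLp

theorem extend_sub_const (z : H1 Ω) (c : ℝ) :
    ∀ᵐ x ∂Ω.meas, extend (z - c • oneH1 Ω) x = extend z x - c := by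
  have h : toL2 Ω (z - c • oneH1 Ω) = toL2 Ω z - c • cOne Ω := by
    rw [map_sub, map_smul, toL2_oneH1]
  filter_upwards [Lp.coeFn_sub (toL2 Ω z) (c • cOne Ω), Lp.coeFn_smul c (cOne Ω), coeFn_cOne,
    ae_restrict_mem Ω.isOpen.measurableSet] with x h1 h2 h3 hx
  rw [extend, extend, indicator_of_mem hx, indicator_of_mem hx, h, h1, Pi.sub_apply, h2,
    Pi.smul_apply, h3, smul_eq_mul, mul_one]

/-- Substitute `x = y + h` and exchange the integrals. Only `‖h‖ < 2 r` contributes, and for each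
such `h` the translation inequality applies because the ball is convex. -/
theorem lintegral_lintegral_sub_le (z : H1 Ω) {x₀ : E3} {r : ℝ}
    (hball : Metric.ball x₀ r ⊆ Ω.carrier) :
    ∫⁻ y in Metric.ball x₀ r, ∫⁻ x in Metric.ball x₀ r, ‖extend z x - extend z y‖ₑ ^ 2
      ≤ ENNReal.ofReal ((2 * r * ‖grad Ω z‖) ^ 2) * volume (Metric.ball (0 : E3) (2 * r)) := by
  set B := Metric.ball x₀ r with hB
  have hBm : MeasurableSet B := Metric.isOpen_ball.measurableSet
  have hm := measurable_extend z
  have hm2 : Measurable fun q : E3 × E3 => ‖extend z (q.1 + q.2) - extend z q.1‖ₑ ^ 2 := by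
    fun_prop
  have h1 : ∀ y, ∫⁻ x in B, ‖extend z x - extend z y‖ₑ ^ 2
      = ∫⁻ h, {q : E3 × E3 | q.1 + q.2 ∈ B}.indicator
        (fun q => ‖extend z (q.1 + q.2) - extend z q.1‖ₑ ^ 2) (y, h) := by
    intro y
    rw [← lintegral_indicator hBm,
      ← lintegral_add_left_eq_self (fun x => B.indicator
        (fun x => ‖extend z x - extend z y‖ₑ ^ 2) x) y]
    refine lintegral_congr fun h => ?_
    by_cases hx : y + h ∈ B <;> simp [hx]
  simp_rw [h1]
  have hS : MeasurableSet {q : E3 × E3 | q.1 + q.2 ∈ B} := measurable_add hBm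
  rw [lintegral_lintegral_swap (f := fun y h => {q : E3 × E3 | q.1 + q.2 ∈ B}.indicator
    (fun q => ‖extend z (q.1 + q.2) - extend z q.1‖ₑ ^ 2) (y, h)) (hm2.indicator hS).aemeasurable]
  have h2 : ∀ h, ∫⁻ y in B, {q : E3 × E3 | q.1 + q.2 ∈ B}.indicator
        (fun q => ‖extend z (q.1 + q.2) - extend z q.1‖ₑ ^ 2) (y, h)
      ≤ (Metric.ball (0 : E3) (2 * r)).indicator
        (fun _ => ENNReal.ofReal ((2 * r * ‖grad Ω z‖) ^ 2)) h := by
    intro h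
    by_cases hh : h ∈ Metric.ball (0 : E3) (2 * r)
    · rw [indicator_of_mem hh]
      have hn : ‖h‖ ≤ 2 * r := (mem_ball_zero_iff.1 hh).le
      calc _ ≤ ∫⁻ y in shiftable Ω h, ‖extend z (y + h) - extend z y‖ₑ ^ 2 := by
            rw [← lintegral_indicator hBm, ← lintegral_indicator (isOpen_shiftable h).measurableSet]
            refine lintegral_mono fun y => ?_
            by_cases hy : y ∈ B
            · by_cases hyh : y + h ∈ B
              · have := mem_shiftable_of_mem_ball hball hy hyh
                simp [hy, hyh, this]
              · simp [hy, hyh]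
            · simp [hy]
        _ ≤ _ := lintegral_sub_shift_le z h
        _ ≤ _ := ENNReal.ofReal_le_ofReal (by gcongr)
    · rw [indicator_of_notMem hh]
      refine (lintegral_eq_zero_of_ae_eq_zero ?_).le
      filter_upwards [ae_restrict_mem hBm] with y hy
      have hnot : (y, h) ∉ {q : E3 × E3 | q.1 + q.2 ∈ B} := ?_
      · exact indicator_of_notMem hnot _
      refine fun hyh : y + h ∈ B => hh ?_
      rw [mem_ball_zero_iff]
      rw [hB, Metric.mem_ball, dist_eq_norm] at hy hyh
      calc ‖h‖ = ‖(y + h - x₀) - (y - x₀)‖ := by congr 1; abel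
        _ ≤ ‖y + h - x₀‖ + ‖y - x₀‖ := norm_sub_le _ _
        _ < 2 * r := by linarith
  refine (lintegral_mono h2).trans ?_
  rw [lintegral_indicator Metric.isOpen_ball.measurableSet, setLIntegral_const]

theorem toL2_norm_sq_eq_mass (z : H1 Ω) :
    mass z Ω.carrier = ENNReal.ofReal (‖toL2 Ω z‖ ^ 2) := by
  rw [← lintegral_enorm_sq, mass]
  refine setLIntegral_congr_fun Ω.isOpen.measurableSet fun x hx => ?_
  simp only [extend, indicator_of_mem hx]

/-- The distance to the constants is controlled by the gradient. -/
theorem exists_norm_sub_const_le (Ω : Domain) :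
    ∃ C : ℝ, 0 ≤ C ∧ ∀ z : H1 Ω, ∃ c : ℝ, ‖toL2 Ω z - c • cOne Ω‖ ≤ C * ‖grad Ω z‖ := by
  obtain ⟨x₀, h₀⟩ := Ω.isConnected.nonempty
  obtain ⟨r, hr, hball⟩ := Metric.isOpen_iff.1 Ω.isOpen x₀ h₀
  obtain ⟨C, hC⟩ := controlled_domain hr h₀
  set B := Metric.ball x₀ r with hB
  set V := volume (Metric.ball (0 : E3) (2 * r)) with hV
  have hVtop : V ≠ ⊤ := measure_ball_lt_top.ne
  have hB0 : volume B ≠ 0 := (Metric.measure_ball_pos volume x₀ hr).ne'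
  have hBtop : volume B ≠ ⊤ := measure_ball_lt_top.ne
  set M : ℝ := (2 * r) ^ 2 * V.toReal / (volume B).toReal with hM
  have hM0 : 0 ≤ M := by positivity
  refine ⟨Real.sqrt (C * (M + 1)), Real.sqrt_nonneg _, fun z => ?_⟩
  have hm := measurable_extend z
  have hmF : Measurable fun y => ∫⁻ x in B, ‖extend z x - extend z y‖ₑ ^ 2 := by
    refine Measurable.lintegral_prod_right' (f := fun q : E3 × E3 =>
      ‖extend z q.2 - extend z q.1‖ₑ ^ 2) ?_
    fun_prop
  -- The constant is a value `z(y)` at a point where the inner integral is at most its average over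
  -- the ball; the division by the volume of the ball produces `M`.
  obtain ⟨y, -, hy⟩ := exists_le_setLAverage hB0 hBtop hmF.aemeasurable
  rw [setLAverage_eq] at hy
  set c := extend z y with hc
  have hyM : ∫⁻ x in B, ‖extend z x - c‖ₑ ^ 2 ≤ ENNReal.ofReal (M * ‖grad Ω z‖ ^ 2) := by
    refine hy.trans ((ENNReal.div_le_div_right (lintegral_lintegral_sub_le z hball) _).trans ?_)
    rw [← hV, ← ENNReal.ofReal_toReal hVtop, ← ENNReal.ofReal_toReal hBtop,
      ← ENNReal.ofReal_mul (by positivity), ← ENNReal.ofReal_div_of_pos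
        (ENNReal.toReal_pos hB0 hBtop)]
    refine ENNReal.ofReal_le_ofReal (le_of_eq ?_)
    rw [hM]
    ring
  refine ⟨c, ?_⟩
  have hz := hC (z - c • oneH1 Ω)
  have e1 : mass (z - c • oneH1 Ω) B = ∫⁻ x in B, ‖extend z x - c‖ₑ ^ 2 := by
    refine lintegral_congr_ae ?_
    filter_upwards [ae_restrict_of_ae_restrict_of_subset hball (extend_sub_const z c)] with x hx
    rw [hx]
  have e2 : grad Ω (z - c • oneH1 Ω) = grad Ω z := by
    rw [map_sub, map_smul, grad_oneH1, smul_zero, sub_zero]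
  have e3 : toL2 Ω (z - c • oneH1 Ω) = toL2 Ω z - c • cOne Ω := by
    rw [map_sub, map_smul, toL2_oneH1]
  rw [toL2_norm_sq_eq_mass, e1, e2, e3] at hz
  have h5 : ENNReal.ofReal (‖toL2 Ω z - c • cOne Ω‖ ^ 2)
      ≤ ENNReal.ofReal (C * (M + 1) * ‖grad Ω z‖ ^ 2) := by
    refine hz.trans ((mul_le_mul_right (add_le_add_left hyM _) _).trans (le_of_eq ?_))
    rw [← ENNReal.ofReal_add (by positivity) (by positivity), ← ENNReal.ofReal_coe_nnreal,
      ← ENNReal.ofReal_mul (by positivity)]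
    congr 1
    ring
  rw [ENNReal.ofReal_le_ofReal_iff (by positivity)] at h5
  refine le_of_sq_le_sq ?_ (by positivity)
  rwa [mul_pow, Real.sq_sqrt (by positivity)]

theorem norm_cOne_pos (Ω : Domain) : 0 < ‖cOne Ω‖ := by
  rw [norm_pos_iff]
  intro h
  have h1 := coeFn_cOne (Ω := Ω)
  rw [h] at h1
  have h2 : ∀ᵐ _x ∂Ω.meas, False := by
    filter_upwards [h1, Lp.coeFn_zero ℝ 2 Ω.meas] with x h3 h4
    rw [h4] at h3
    simp at h3
  have h3 := Ω.isOpen.measure_pos volume Ω.isConnected.nonempty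
  rw [ae_iff] at h2
  simp at h2
  exact h3.ne' h2

/-- The Poincaré inequality. -/
theorem poincare (Ω : Domain) :
    ∃ C : ℝ, 0 ≤ C ∧ ∀ z : H1 Ω, ‖toL2 Ω z‖ ≤ C * (‖grad Ω z‖ + |cDual Ω z|) := by
  obtain ⟨C, hC0, hC⟩ := exists_norm_sub_const_le Ω
  have he := norm_cOne_pos Ω
  -- Pairing `z` with `1` bounds `|c| ‖1‖` by `|⟨1, z⟩| / ‖1‖ + ‖z - c‖`. The distance `‖z - c‖`
  -- thus enters twice, hence `2 * C`.
  refine ⟨2 * C + 1 / ‖cOne Ω‖, by positivity, fun z => ?_⟩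
  obtain ⟨c, hc⟩ := hC z
  have h1 : ‖toL2 Ω z‖ ≤ ‖toL2 Ω z - c • cOne Ω‖ + |c| * ‖cOne Ω‖ := by
    have := norm_add_le (toL2 Ω z - c • cOne Ω) (c • cOne Ω)
    rwa [sub_add_cancel, norm_smul, Real.norm_eq_abs] at this
  have h2 : |c| * ‖cOne Ω‖ ^ 2 ≤ |cDual Ω z| + ‖cOne Ω‖ * ‖toL2 Ω z - c • cOne Ω‖ := by
    have e : cDual Ω z = inner ℝ (cOne Ω) (toL2 Ω z - c • cOne Ω) + c * ‖cOne Ω‖ ^ 2 := by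
      rw [inner_sub_right, real_inner_smul_right, real_inner_self_eq_norm_sq, sub_add_cancel]
      rfl
    have h3 := abs_real_inner_le_norm (cOne Ω) (toL2 Ω z - c • cOne Ω)
    have h4 : |c * ‖cOne Ω‖ ^ 2| = |c| * ‖cOne Ω‖ ^ 2 := by
      rw [abs_mul, abs_of_nonneg (sq_nonneg ‖cOne Ω‖)]
    rw [← h4, show c * ‖cOne Ω‖ ^ 2 = cDual Ω z - inner ℝ (cOne Ω) (toL2 Ω z - c • cOne Ω) by
      rw [e]; ring]
    exact (abs_sub _ _).trans (by linarith)
  have h3 : |c| * ‖cOne Ω‖ ≤ 1 / ‖cOne Ω‖ * |cDual Ω z| + ‖toL2 Ω z - c • cOne Ω‖ := by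
    refine le_of_mul_le_mul_right ?_ he
    calc |c| * ‖cOne Ω‖ * ‖cOne Ω‖ = |c| * ‖cOne Ω‖ ^ 2 := by ring
      _ ≤ _ := h2
      _ = _ := by field_simp
  have h4 : 0 ≤ 1 / ‖cOne Ω‖ * ‖grad Ω z‖ := by positivity
  have h5 : 0 ≤ C * |cDual Ω z| := by positivity
  nlinarith

end

section

/-! ### The weighted gradient -/

variable {Ω : Domain} {γ ε : ℝ}

theorem wgrad_eq (a b : ℝ) : wgrad Ω a b = a • wgrad Ω 1 0 + b • wgrad Ω 0 1 := by
  have h : Matrix.toEuclideanCLM (n := Fin 3) (𝕜 := ℝ) (Matrix.diagonal ![a, a, b])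
      = a • Matrix.toEuclideanCLM (n := Fin 3) (𝕜 := ℝ) (Matrix.diagonal ![1, 1, 0])
        + b • Matrix.toEuclideanCLM (n := Fin 3) (𝕜 := ℝ) (Matrix.diagonal ![0, 0, 1]) := by
    rw [← map_smul, ← map_smul, ← map_add, ← Matrix.diagonal_smul, ← Matrix.diagonal_smul,
      Matrix.diagonal_add]
    congr 2
    ext i
    fin_cases i <;> simp
  rw [wgrad, wgrad, wgrad, h, ContinuousLinearMap.add_compLpL, ContinuousLinearMap.smul_compLpL,
    ContinuousLinearMap.smul_compLpL]
  rfl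

theorem wdiv_apply (a b : ℝ) (p : L2v Ω) (z : H1 Ω) :
    wdiv Ω a b p z = - inner ℝ p (wgrad Ω a b z) := rfl

theorem divK_apply (κ : ℝ) (p : L2v Ω) (z : H1 Ω) :
    divK Ω κ p z = - inner ℝ p (gradK Ω κ z) := rfl

theorem wdiv_eq (a b : ℝ) : wdiv Ω a b = a • wdiv Ω 1 0 + b • wdiv Ω 0 1 := by
  ext p z
  simp only [add_apply, smul_apply, wdiv_apply]
  rw [wgrad_eq a b]
  simp only [add_apply, smul_apply, inner_add_right,
    real_inner_smul_right, smul_eq_mul]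
  ring

/-- Affine dependence on `κ`: the slope is the source of the `(1, -1)` operators in `T₁` and, up to
sign, in `T₂`. -/
theorem gradK_eq (κ : ℝ) : gradK Ω κ = wgrad Ω 0 1 + κ • wgrad Ω 1 (-1) := by
  rw [gradK, wgrad_eq κ, wgrad_eq 1 (-1)]
  module

theorem divK_eq (κ : ℝ) : divK Ω κ = wdiv Ω 0 1 + κ • wdiv Ω 1 (-1) := by
  rw [divK, wdiv_eq κ, wdiv_eq 1 (-1)]
  module

theorem wgrad_neg (a b : ℝ) : wgrad Ω (-a) (-b) = -wgrad Ω a b := by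
  rw [wgrad_eq, wgrad_eq a b]
  module

theorem wdiv_neg (a b : ℝ) : wdiv Ω (-a) (-b) = -wdiv Ω a b := by
  rw [wdiv_eq, wdiv_eq a b]
  module

theorem norm_grad_le_norm_wgrad {a b m : ℝ} (hm : 0 < m) (ha : m ≤ |a|) (hb : m ≤ |b|)
    (z : H1 Ω) : m * ‖grad Ω z‖ ≤ ‖wgrad Ω a b z‖ := by
  rw [← le_div_iff₀' hm, div_eq_inv_mul]
  refine Lp.norm_le_mul_norm_of_ae_le_mul ?_
  filter_upwards [ContinuousLinearMap.coeFn_compLpL (Matrix.toEuclideanCLM (n := Fin 3) (𝕜 := ℝ)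
    (Matrix.diagonal ![a, a, b])) (grad Ω z)] with x hx
  change _ ≤ m⁻¹ * ‖ContinuousLinearMap.compLpL 2 Ω.meas (Matrix.toEuclideanCLM (n := Fin 3)
    (𝕜 := ℝ) (Matrix.diagonal ![a, a, b])) (grad Ω z) x‖
  rw [hx, ← div_eq_inv_mul, le_div_iff₀' hm]
  set v := grad Ω z x
  have ha2 : m ^ 2 ≤ a ^ 2 := sq_le_sq.2 (by rwa [abs_of_pos hm])
  have hb2 : m ^ 2 ≤ b ^ 2 := sq_le_sq.2 (by rwa [abs_of_pos hm])
  refine le_of_sq_le_sq ?_ (norm_nonneg _)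
  rw [mul_pow, EuclideanSpace.norm_sq_eq, EuclideanSpace.norm_sq_eq, Fin.sum_univ_three,
    Fin.sum_univ_three]
  simp only [Matrix.ofLp_toEuclideanCLM, Matrix.mulVec_diagonal, Real.norm_eq_abs, sq_abs]
  simp
  nlinarith [mul_le_mul_of_nonneg_right ha2 (sq_nonneg (v 0)),
    mul_le_mul_of_nonneg_right ha2 (sq_nonneg (v 1)),
    mul_le_mul_of_nonneg_right hb2 (sq_nonneg (v 2))]

/-! ### The space `H¹(Ω)` -/

theorem norm_H1_sq (z : H1 Ω) : ‖z‖ ^ 2 = ‖toL2 Ω z‖ ^ 2 + ‖grad Ω z‖ ^ 2 :=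
  WithLp.prod_norm_sq_eq_of_L2 (show WithLp 2 (L2 Ω × L2v Ω) from (show H1sub Ω from z).1)

/-- Each defining identity equates two pairings with fixed `L²` functions, which are continuous.
Completeness of `H¹` follows, as needed for minimisers and for Lax-Milgram. -/
theorem isClosed_H1sub (Ω : Domain) : IsClosed (H1sub Ω : Set (WithLp 2 (L2 Ω × L2v Ω))) := by
  have e : (H1sub Ω : Set (WithLp 2 (L2 Ω × L2v Ω))) = ⋂ (φ : E3 → ℝ)
      (_ : ContDiff ℝ (⊤ : ℕ∞) φ) (_ : HasCompactSupport φ) (_ : tsupport φ ⊆ Ω.carrier)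
      (i : Fin 3), {z | ∫ x, z.fst x * fderiv ℝ φ x (EuclideanSpace.single i 1) ∂Ω.meas
        = - ∫ x, z.snd x i * φ x ∂Ω.meas} := by
    ext z
    simp only [mem_iInter]
    rfl
  rw [e]
  refine isClosed_iInter fun φ => isClosed_iInter fun hφ => isClosed_iInter fun hc =>
    isClosed_iInter fun hs => isClosed_iInter fun i => ?_
  have hd : Continuous fun x => fderiv ℝ φ x (EuclideanSpace.single i (1 : ℝ)) :=
    (hφ.continuous_fderiv (by simp)).clm_apply continuous_const
  have hm1 : MemLp (fun x => fderiv ℝ φ x (EuclideanSpace.single i (1 : ℝ))) 2 Ω.meas :=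
    hd.memLp_of_hasCompactSupport (hc.fderiv_apply (𝕜 := ℝ) _)
  have hm2 : MemLp φ 2 Ω.meas := hφ.continuous.memLp_of_hasCompactSupport hc
  have h1 : ∀ z : WithLp 2 (L2 Ω × L2v Ω),
      ∫ x, z.fst x * fderiv ℝ φ x (EuclideanSpace.single i 1) ∂Ω.meas
        = inner ℝ (hm1.toLp _) z.fst := by
    intro z
    rw [L2.inner_def]
    refine integral_congr_ae ?_
    filter_upwards [hm1.coeFn_toLp] with x hx
    rw [hx]
    simp
  have h2 : ∀ z : WithLp 2 (L2 Ω × L2v Ω), ∫ x, z.snd x i * φ x ∂Ω.meas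
        = inner ℝ (hm2.toLp _) ((EuclideanSpace.proj i : E3 →L[ℝ] ℝ).compLp z.snd) := by
    intro z
    rw [L2.inner_def]
    refine integral_congr_ae ?_
    filter_upwards [hm2.coeFn_toLp, (EuclideanSpace.proj i : E3 →L[ℝ] ℝ).coeFn_compLp z.snd]
      with x hx hx'
    rw [hx, hx']
    simp
  simp_rw [h1, h2]
  have hc1 : Continuous fun z : WithLp 2 (L2 Ω × L2v Ω) => z.fst :=
    (WithLp.fstL 2 ℝ (L2 Ω) (L2v Ω)).continuous
  have hc2 : Continuous fun z : WithLp 2 (L2 Ω × L2v Ω) =>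
      (EuclideanSpace.proj i : E3 →L[ℝ] ℝ).compLp z.snd :=
    ((EuclideanSpace.proj i : E3 →L[ℝ] ℝ).compLpL 2 Ω.meas).continuous.comp
      (WithLp.sndL 2 ℝ (L2 Ω) (L2v Ω)).continuous
  exact isClosed_eq (continuous_const.inner hc1) (continuous_const.inner hc2).neg

instance : CompleteSpace (H1 Ω) :=
  (isClosed_H1sub Ω).completeSpace_coe

/-! ### Coercivity -/

/-- The quadratic form that bounds the second derivative of the functional from below. -/
def quadForm (ε : ℝ) (a : ℝ × ℝ × ℝ) (d : H1 Ω × H1 Ω) : ℝ :=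
  ‖toL2 Ω d.1‖ ^ 2 + a.1 * (ε * ‖gradK Ω a.2.2 (d.1 - d.2)‖ ^ 2)
    + a.2.1 * (ε * ‖gradK Ω (1 - a.2.2) d.2‖ ^ 2) + cDual Ω d.2 ^ 2

/-- A modulus of coercivity that depends continuously on the parameters. -/
def modulus (ε : ℝ) (a : ℝ × ℝ × ℝ) : ℝ :=
  min 1 (min (a.1 * ε) (a.2.1 * ε) * min |a.2.2| |1 - a.2.2| ^ 2)

theorem modulus_pos (hε : 0 < ε) {a : ℝ × ℝ × ℝ} (ha : Admissible a) : 0 < modulus ε a := by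
  obtain ⟨h1, h2, h3, h4⟩ := ha
  have h5 : 0 < |a.2.2| := abs_pos.2 h3
  have h6 : 0 < |1 - a.2.2| := abs_pos.2 (sub_ne_zero.2 h4.symm)
  unfold modulus
  positivity

theorem continuous_modulus (ε : ℝ) : Continuous (modulus ε) := by
  unfold modulus
  fun_prop

theorem isOpen_admissible : IsOpen {a | Admissible a} := by
  refine (isOpen_lt continuous_const continuous_fst).inter
    ((isOpen_lt continuous_const (by fun_prop : Continuous fun a : ℝ × ℝ × ℝ => a.2.1)).inter
      ((isOpen_ne_fun (by fun_prop : Continuous fun a : ℝ × ℝ × ℝ => a.2.2)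
        continuous_const).inter (isOpen_ne_fun (by fun_prop) continuous_const)))

/-- The gradient of `u` is bounded by those of `u - w` and `w`; the `L²` norm of `w` by Poincaré.
The constant `c` depends on the domain only through Poincaré and not on `a`, which makes the later
estimates locally uniform in the parameters. -/
theorem exists_modulus_mul_le_quadForm (Ω : Domain) (hε : 0 < ε) :
    ∃ c > 0, ∀ a, Admissible a → ∀ d : H1 Ω × H1 Ω, c * modulus ε a * ‖d‖ ^ 2 ≤ quadForm ε a d := by
  obtain ⟨C, hC0, hC⟩ := poincare Ω
  refine ⟨(2 * C ^ 2 + 2)⁻¹, by positivity, fun a ha d => ?_⟩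
  have hμ := modulus_pos hε ha
  obtain ⟨h1, h2, h3, h4⟩ := ha
  set k := min |a.2.2| |1 - a.2.2| with hk
  have hk0 : 0 < k := lt_min (abs_pos.2 h3) (abs_pos.2 (sub_ne_zero.2 h4.symm))
  have g1 : k ^ 2 * ‖grad Ω (d.1 - d.2)‖ ^ 2 ≤ ‖gradK Ω a.2.2 (d.1 - d.2)‖ ^ 2 := by
    rw [← mul_pow]
    exact pow_le_pow_left₀ (by positivity)
      (norm_grad_le_norm_wgrad hk0 (min_le_left _ _) (min_le_right _ _) _) 2
  have g2 : k ^ 2 * ‖grad Ω d.2‖ ^ 2 ≤ ‖gradK Ω (1 - a.2.2) d.2‖ ^ 2 := by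
    rw [← mul_pow]
    exact pow_le_pow_left₀ (by positivity) (norm_grad_le_norm_wgrad hk0 (min_le_right _ _)
      (by rw [sub_sub_cancel]; exact min_le_left _ _) _) 2
  set A := ‖grad Ω (d.1 - d.2)‖ with hA
  set B := ‖grad Ω d.2‖ with hB
  set D := cDual Ω d.2 with hD
  set F := ‖toL2 Ω d.1‖ with hF
  set μ := modulus ε a with hμdef
  have m1 : μ ≤ 1 := min_le_left _ _
  have m0 : μ ≤ min (a.1 * ε) (a.2.1 * ε) * k ^ 2 := min_le_right _ _
  have m2 : μ ≤ a.1 * ε * k ^ 2 :=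
    m0.trans (mul_le_mul_of_nonneg_right (min_le_left _ _) (sq_nonneg _))
  have m3 : μ ≤ a.2.1 * ε * k ^ 2 :=
    m0.trans (mul_le_mul_of_nonneg_right (min_le_right _ _) (sq_nonneg _))
  have q1 : μ * (F ^ 2 + A ^ 2 + B ^ 2 + D ^ 2) ≤ quadForm ε a d := by
    have t1 : μ * A ^ 2 ≤ a.1 * (ε * ‖gradK Ω a.2.2 (d.1 - d.2)‖ ^ 2) :=
      calc μ * A ^ 2 ≤ a.1 * ε * k ^ 2 * A ^ 2 := mul_le_mul_of_nonneg_right m2 (sq_nonneg _)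
        _ = a.1 * ε * (k ^ 2 * A ^ 2) := by ring
        _ ≤ a.1 * ε * ‖gradK Ω a.2.2 (d.1 - d.2)‖ ^ 2 :=
          mul_le_mul_of_nonneg_left g1 (by positivity)
        _ = _ := by ring
    have t2 : μ * B ^ 2 ≤ a.2.1 * (ε * ‖gradK Ω (1 - a.2.2) d.2‖ ^ 2) :=
      calc μ * B ^ 2 ≤ a.2.1 * ε * k ^ 2 * B ^ 2 := mul_le_mul_of_nonneg_right m3 (sq_nonneg _)
        _ = a.2.1 * ε * (k ^ 2 * B ^ 2) := by ring
        _ ≤ a.2.1 * ε * ‖gradK Ω (1 - a.2.2) d.2‖ ^ 2 :=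
          mul_le_mul_of_nonneg_left g2 (by positivity)
        _ = _ := by ring
    have t3 : μ * F ^ 2 ≤ 1 * F ^ 2 := mul_le_mul_of_nonneg_right m1 (sq_nonneg _)
    have t4 : μ * D ^ 2 ≤ 1 * D ^ 2 := mul_le_mul_of_nonneg_right m1 (sq_nonneg _)
    unfold quadForm
    linarith
  have n2 : ‖d.2‖ ^ 2 ≤ (2 * C ^ 2 + 2) * (F ^ 2 + A ^ 2 + B ^ 2 + D ^ 2) := by
    have t := pow_le_pow_left₀ (norm_nonneg _) (hC d.2) 2
    rw [norm_H1_sq]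
    have t2 : (B + |D|) ^ 2 ≤ 2 * (B ^ 2 + D ^ 2) := by
      rw [← sq_abs D]
      nlinarith [sq_nonneg (B - |D|)]
    have t3 := mul_le_mul_of_nonneg_left t2 (sq_nonneg C)
    rw [mul_pow] at t
    nlinarith [sq_nonneg F, sq_nonneg A, sq_nonneg B, sq_nonneg D, mul_nonneg (sq_nonneg C)
      (sq_nonneg F), mul_nonneg (sq_nonneg C) (sq_nonneg A)]
  have n1 : ‖d.1‖ ^ 2 ≤ (2 * C ^ 2 + 2) * (F ^ 2 + A ^ 2 + B ^ 2 + D ^ 2) := by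
    have t : ‖grad Ω d.1‖ ≤ A + B := by
      have := norm_add_le (grad Ω (d.1 - d.2)) (grad Ω d.2)
      rwa [← map_add, sub_add_cancel] at this
    have t2 := pow_le_pow_left₀ (norm_nonneg _) t 2
    rw [norm_H1_sq]
    have : 0 ≤ C ^ 2 * (F ^ 2 + A ^ 2 + B ^ 2 + D ^ 2) := by positivity
    nlinarith [sq_nonneg (A - B), sq_nonneg F, sq_nonneg D]
  have n : ‖d‖ ^ 2 ≤ (2 * C ^ 2 + 2) * (F ^ 2 + A ^ 2 + B ^ 2 + D ^ 2) := by
    rw [Prod.norm_def]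
    rcases max_choice ‖d.1‖ ‖d.2‖ with h | h <;> rw [h] <;> assumption
  refine le_trans ?_ q1
  rw [mul_comm _ μ, mul_assoc]
  exact mul_le_mul_of_nonneg_left ((inv_mul_le_iff₀ (by positivity)).2 n) hμ.le

end

section

/-! ### The Euler-Lagrange operator -/

variable {Ω : Domain} {γ ε : ℝ}

/-- The Euler-Lagrange operator before the change of variables `Q*`. -/
def eulerPre (g : L2 Ω) (γ ε : ℝ) (U : H1 Ω × H1 Ω) (a : ℝ × ℝ × ℝ) : H1dual Ω × H1dual Ω :=
  (idDual Ω U.1 - (ip (L2 Ω) g).comp (toL2 Ω) - a.1 • divK Ω a.2.2 (Psi1 γ ε a.2.2 (U.1 - U.2)),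
    idDual Ω U.1 - (ip (L2 Ω) g).comp (toL2 Ω)
      - a.2.1 • divK Ω (1 - a.2.2) (Psi1 γ ε (1 - a.2.2) U.2) + cTensor Ω U.2)

/-- The explicit form of the Euler-Lagrange operator. -/
def euler (g : L2 Ω) (γ ε : ℝ) (U : H1 Ω × H1 Ω) (a : ℝ × ℝ × ℝ) : H1dual Ω × H1dual Ω :=
  Qstar Ω (eulerPre g γ ε U a)

theorem idDual_apply (u φ : H1 Ω) : idDual Ω u φ = inner ℝ (toL2 Ω u) (toL2 Ω φ) := rfl

theorem cTensor_apply (u φ : H1 Ω) : cTensor Ω u φ = cDual Ω u * cDual Ω φ := by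
  simp [cTensor]

theorem Qstar_apply (A : H1dual Ω × H1dual Ω) : Qstar Ω A = (A.1, A.2 - A.1) := by
  simp [Qstar, block, sub_eq_neg_add]

theorem Q_apply (U : H1 Ω × H1 Ω) : Q Ω U = (U.1 - U.2, U.2) := by
  simp [Q, block, sub_eq_add_neg]

theorem integral_toL2 (z : H1 Ω) : ∫ x, toL2 Ω z x ∂Ω.meas = cDual Ω z := by
  change _ = inner ℝ (cOne Ω) (toL2 Ω z)
  rw [L2.inner_def]
  refine integral_congr_ae ?_
  filter_upwards [coeFn_cOne (Ω := Ω)] with x hx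
  rw [hx]
  simp

/-- The Euler-Lagrange operator paired with a direction. -/
theorem euler_apply (g : L2 Ω) (U d : H1 Ω × H1 Ω) (a : ℝ × ℝ × ℝ) :
    (euler g γ ε U a).1 d.1 + (euler g γ ε U a).2 d.2
      = inner ℝ (toL2 Ω U.1 - g) (toL2 Ω d.1)
        + a.1 * inner ℝ (Psi1 γ ε a.2.2 (U.1 - U.2)) (gradK Ω a.2.2 (d.1 - d.2))
        + a.2.1 * inner ℝ (Psi1 γ ε (1 - a.2.2) U.2) (gradK Ω (1 - a.2.2) d.2)
        + cDual Ω U.2 * cDual Ω d.2 := by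
  simp only [euler, Qstar_apply, eulerPre, add_apply, sub_apply, smul_apply, idDual_apply,
    divK_apply, cTensor_apply, ContinuousLinearMap.comp_apply, ip_apply, smul_eq_mul, map_sub,
    inner_sub_left, inner_sub_right]
  ring

theorem psi1_eq (hγ : 0 < γ) (hε : 0 < ε) (κ : ℝ) (v : H1 Ω) :
    Psi1 γ ε κ v = thetaGrad Ω hγ ε (gradK Ω κ v) := by
  rw [Psi1, gradient_theta hγ hε]

theorem hasFDerivAt_J (hγ : 0 < γ) (hε : 0 < ε) (g : L2 Ω) (a : ℝ × ℝ × ℝ) (U : H1 Ω × H1 Ω) :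
    HasFDerivAt (fun V => J g γ ε V a)
      ((euler g γ ε U a).1.coprod (euler g γ ε U a).2) U := by
  have h1 : HasFDerivAt (fun V : H1 Ω × H1 Ω => toL2 Ω V.1 - g)
      ((toL2 Ω).comp (ContinuousLinearMap.fst ℝ (H1 Ω) (H1 Ω))) U :=
    ((toL2 Ω).comp (ContinuousLinearMap.fst ℝ (H1 Ω) (H1 Ω))).hasFDerivAt.sub_const g
  have h2 : ∀ κ (L : H1 Ω × H1 Ω →L[ℝ] H1 Ω), HasFDerivAt
      (fun V : H1 Ω × H1 Ω => Theta γ ε (gradK Ω κ (L V)))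
      ((InnerProductSpace.toDual ℝ (L2v Ω) (Psi1 γ ε κ (L U))).comp ((gradK Ω κ).comp L)) U := by
    intro κ L
    rw [psi1_eq hγ hε]
    exact (hasGradientAt_theta hγ hε _).hasFDerivAt.comp U ((gradK Ω κ).comp L).hasFDerivAt
  have h3 : HasFDerivAt (fun V : H1 Ω × H1 Ω => ∫ x, toL2 Ω V.2 x ∂Ω.meas)
      ((cDual Ω).comp (ContinuousLinearMap.snd ℝ (H1 Ω) (H1 Ω))) U := by
    simp_rw [integral_toL2]
    exact ((cDual Ω).comp (ContinuousLinearMap.snd ℝ (H1 Ω) (H1 Ω))).hasFDerivAt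
  have h4 := (((h1.norm_sq.const_mul (1 / 2)).add ((h2 a.2.2
    (ContinuousLinearMap.fst ℝ (H1 Ω) (H1 Ω) - ContinuousLinearMap.snd ℝ (H1 Ω) (H1 Ω))).const_mul
    a.1)).add ((h2 (1 - a.2.2) (ContinuousLinearMap.snd ℝ (H1 Ω) (H1 Ω))).const_mul a.2.1)).add
    ((h3.pow 2).const_mul (1 / 2))
  refine h4.congr_fderiv ?_
  refine ContinuousLinearMap.ext fun d => ?_
  rw [ContinuousLinearMap.coprod_apply, euler_apply]
  simp [integral_toL2, inner_sub_left, inner_sub_right]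
  ring

theorem S_eq_euler (hγ : 0 < γ) (hε : 0 < ε) (g : L2 Ω) : S g γ ε = euler g γ ε := by
  ext1 U
  ext1 a
  rw [S, (hasFDerivAt_J hγ hε g a U).fderiv, ContinuousLinearMap.coprod_comp_inl,
    ContinuousLinearMap.coprod_comp_inr]

/-- The duality pairing of `(H¹(Ω)*)²` with `H¹(Ω)²` is bounded by the norms. -/
theorem pairing_le (A : H1dual Ω × H1dual Ω) (d : H1 Ω × H1 Ω) :
    A.1 d.1 + A.2 d.2 ≤ 2 * ‖A‖ * ‖d‖ := by
  have h1 := (le_abs_self _).trans (A.1.le_opNorm d.1)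
  have h2 := (le_abs_self _).trans (A.2.le_opNorm d.2)
  have h3 : ‖A.1‖ * ‖d.1‖ ≤ ‖A‖ * ‖d‖ := mul_le_mul (norm_fst_le A) (norm_fst_le d)
    (norm_nonneg _) (norm_nonneg _)
  have h4 : ‖A.2‖ * ‖d.2‖ ≤ ‖A‖ * ‖d‖ := mul_le_mul (norm_snd_le A) (norm_snd_le d)
    (norm_nonneg _) (norm_nonneg _)
  linarith

/-- Strong convexity of `J`: the two squares expand exactly, and each `Θ` term contributes its `ε /
2` excess. -/
theorem J_add_le (hγ : 0 < γ) (hε : 0 < ε) (g : L2 Ω) {a : ℝ × ℝ × ℝ} (ha : Admissible a)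
    (U V : H1 Ω × H1 Ω) :
    J g γ ε U a + ((euler g γ ε U a).1 (V - U).1 + (euler g γ ε U a).2 (V - U).2)
      + 1 / 2 * quadForm ε a (V - U) ≤ J g γ ε V a := by
  rw [euler_apply]
  have h1 := norm_sq_eq_add (toL2 Ω U.1 - g) (toL2 Ω V.1 - g)
  have h2 := mul_le_mul_of_nonneg_left (theta_add_inner_le (ε := ε) hγ
    (gradK Ω a.2.2 (U.1 - U.2)) (gradK Ω a.2.2 (V.1 - V.2))) ha.1.le
  have h3 := mul_le_mul_of_nonneg_left (theta_add_inner_le (ε := ε) hγ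
    (gradK Ω (1 - a.2.2) U.2) (gradK Ω (1 - a.2.2) V.2)) ha.2.1.le
  rw [sub_sub_sub_cancel_right] at h1
  rw [← map_sub, show V.1 - V.2 - (U.1 - U.2) = (V - U).1 - (V - U).2 by
    simp only [Prod.fst_sub, Prod.snd_sub]; abel, ← psi1_eq hγ hε] at h2
  rw [← map_sub, ← psi1_eq hγ hε] at h3
  simp only [J, quadForm, integral_toL2, Prod.fst_sub, Prod.snd_sub, map_sub] at *
  nlinarith

/-- Strong monotonicity of the Euler-Lagrange operator. -/
theorem quadForm_le_euler_sub (hγ : 0 < γ) (hε : 0 < ε) (g : L2 Ω) {a : ℝ × ℝ × ℝ}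
    (ha : Admissible a) (U V : H1 Ω × H1 Ω) :
    quadForm ε a (V - U) ≤ (euler g γ ε V a - euler g γ ε U a).1 (V - U).1
      + (euler g γ ε V a - euler g γ ε U a).2 (V - U).2 := by
  have h1 := J_add_le hγ hε g ha U V
  have h2 := J_add_le hγ hε g ha V U
  have h3 : quadForm ε a (U - V) = quadForm ε a (V - U) := by
    rw [← neg_sub V U]
    simp only [quadForm, Prod.fst_neg, Prod.snd_neg, map_neg, norm_neg, neg_sq]
    rw [← neg_sub', map_neg, norm_neg]
  rw [h3, ← neg_sub V U] at h2
  simp only [Prod.fst_neg, Prod.snd_neg, map_neg] at h2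
  simp only [Prod.fst_sub (euler g γ ε V a), Prod.snd_sub (euler g γ ε V a), sub_apply]
  linarith

/-! ### Existence and uniqueness of minimisers -/

/-- The hypothesis makes every minimising sequence Cauchy, so no weak compactness is needed. -/
theorem exists_forall_le_of_sq_dist_le {X : Type*} [MetricSpace X] [CompleteSpace X] [Nonempty X]
    {f : X → ℝ} (hf : Continuous f) (hb : BddBelow (range f)) {c : ℝ} (hc : 0 < c)
    (h : ∀ x y, c * dist x y ^ 2 ≤ f x + f y - 2 * ⨅ z, f z) : ∃ x, ∀ y, f x ≤ f y := by
  set m := ⨅ z, f z with hm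
  have hex : ∀ n : ℕ, ∃ x, f x < m + 1 / (n + 1) := fun n =>
    exists_lt_of_ciInf_lt (lt_add_of_pos_right _ Nat.one_div_pos_of_nat)
  choose u hu using hex
  have hcau : CauchySeq u := by
    rw [Metric.cauchySeq_iff']
    intro δ hδ
    obtain ⟨N, hN⟩ := exists_nat_one_div_lt (show 0 < c * δ ^ 2 / 2 by positivity)
    refine ⟨N, fun n hn => ?_⟩
    have h1 := h (u n) (u N)
    have h2 : 1 / ((n : ℝ) + 1) ≤ 1 / (N + 1) := Nat.one_div_le_one_div hn
    have h3 : c * dist (u n) (u N) ^ 2 < c * δ ^ 2 := by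
      linarith [hu n, hu N]
    exact lt_of_pow_lt_pow_left₀ 2 hδ.le (lt_of_mul_lt_mul_left h3 hc.le)
  obtain ⟨x, hx⟩ := cauchySeq_tendsto_of_complete hcau
  refine ⟨x, fun y => ?_⟩
  have h1 : Tendsto (fun n => f (u n)) atTop (𝓝 (f x)) := (hf.tendsto x).comp hx
  have h2 : Tendsto (fun n : ℕ => m + 1 / ((n : ℝ) + 1)) atTop (𝓝 (m + 0)) :=
    tendsto_one_div_add_atTop_nhds_zero_nat.const_add m
  have h3 := le_of_tendsto_of_tendsto' h1 h2 fun n => (hu n).le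
  rw [add_zero] at h3
  exact h3.trans (ciInf_le hb y)

theorem J_nonneg (hγ : 0 < γ) (hε : 0 < ε) (g : L2 Ω) {a : ℝ × ℝ × ℝ} (ha : Admissible a)
    (U : H1 Ω × H1 Ω) : 0 ≤ J g γ ε U a := by
  have h : ∀ p : L2v Ω, 0 ≤ Theta γ ε p := fun p =>
    add_nonneg (integral_nonneg fun x => huber_norm_nonneg hγ _) (by positivity)
  have h1 := mul_nonneg ha.1.le (h (gradK Ω a.2.2 (U.1 - U.2)))
  have h2 := mul_nonneg ha.2.1.le (h (gradK Ω (1 - a.2.2) U.2))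
  unfold J
  positivity

theorem continuous_J (hγ : 0 < γ) (hε : 0 < ε) (g : L2 Ω) (a : ℝ × ℝ × ℝ) :
    Continuous fun U => J g γ ε U a :=
  continuous_iff_continuousAt.2 fun U => (hasFDerivAt_J hγ hε g a U).continuousAt

theorem exists_isMinimiser (hγ : 0 < γ) (hε : 0 < ε) (g : L2 Ω) {a : ℝ × ℝ × ℝ}
    (ha : Admissible a) : ∃ U, IsMinimiser g γ ε a U := by
  obtain ⟨c, hc0, hc⟩ := exists_modulus_mul_le_quadForm Ω hε
  have hμ := modulus_pos hε ha
  have hb : BddBelow (range fun U => J g γ ε U a) :=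
    ⟨0, by rintro _ ⟨U, rfl⟩; exact J_nonneg hγ hε g ha U⟩
  refine exists_forall_le_of_sq_dist_le (continuous_J hγ hε g a) hb
    (show 0 < c * modulus ε a / 4 by positivity) fun U V => ?_
  -- Strong convexity at the midpoint: the linear terms cancel, and the two quadratic excesses, at
  -- distance `‖U - V‖ / 2`, add up to the factor `c * modulus ε a / 4`.
  set M : H1 Ω × H1 Ω := (1 / 2 : ℝ) • (U + V) with hM
  have e1 : U - M = (1 / 2 : ℝ) • (U - V) := by rw [hM]; module
  have e2 : V - M = -((1 / 2 : ℝ) • (U - V)) := by rw [hM]; module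
  have h1 := J_add_le hγ hε g ha M U
  have h2 := J_add_le hγ hε g ha M V
  have h3 := hc a ha (U - M)
  have h4 := hc a ha (V - M)
  rw [e1] at h1 h3
  rw [e2] at h2 h4
  rw [norm_neg] at h4
  rw [norm_smul, mul_pow, Real.norm_of_nonneg (by norm_num)] at h3 h4
  simp only [Prod.fst_neg, Prod.snd_neg, map_neg] at h2
  have h5 : (⨅ W, J g γ ε W a) ≤ J g γ ε M a := ciInf_le hb M
  rw [dist_eq_norm]
  linarith

theorem IsMinimiser.euler_eq_zero (hγ : 0 < γ) (hε : 0 < ε) {g : L2 Ω} {a : ℝ × ℝ × ℝ}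
    {U : H1 Ω × H1 Ω} (h : IsMinimiser g γ ε a U) : euler g γ ε U a = 0 := by
  have hmin : IsLocalMin (fun V => J g γ ε V a) U := Eventually.of_forall h
  have h0 := hmin.hasFDerivAt_eq_zero (hasFDerivAt_J hγ hε g a U)
  ext d
  · simpa using DFunLike.congr_fun h0 (d, (0 : H1 Ω))
  · simpa using DFunLike.congr_fun h0 ((0 : H1 Ω), d)

theorem IsMinimiser.unique (hγ : 0 < γ) (hε : 0 < ε) {g : L2 Ω} {a : ℝ × ℝ × ℝ}
    (ha : Admissible a) {U V : H1 Ω × H1 Ω} (hU : IsMinimiser g γ ε a U)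
    (hV : IsMinimiser g γ ε a V) : U = V := by
  obtain ⟨c, hc0, hc⟩ := exists_modulus_mul_le_quadForm Ω hε
  have hμ := modulus_pos hε ha
  have h1 := quadForm_le_euler_sub hγ hε g ha V U
  rw [hU.euler_eq_zero hγ hε, hV.euler_eq_zero hγ hε] at h1
  have h2 := (hc a ha (U - V)).trans h1
  simp only [sub_self, Prod.fst_zero, Prod.snd_zero, zero_apply, add_zero] at h2
  have h3 : ‖U - V‖ ^ 2 ≤ 0 := by
    by_contra! h
    have : 0 < c * modulus ε a * ‖U - V‖ ^ 2 := by positivity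
    linarith
  rw [← sub_eq_zero, ← norm_eq_zero]
  exact pow_eq_zero_iff two_ne_zero |>.1 (le_antisymm h3 (sq_nonneg _))

theorem isMinimiser_Rhat (hγ : 0 < γ) (hε : 0 < ε) (g : L2 Ω) {a : ℝ × ℝ × ℝ}
    (ha : Admissible a) : IsMinimiser g γ ε a (Rhat g γ ε a) := by
  have h := exists_isMinimiser hγ hε g ha
  rw [Rhat, dif_pos h]
  exact h.choose_spec

end

section

/-! ### Derivatives of the Euler-Lagrange operator -/

variable {Ω : Domain} {γ ε : ℝ}

section Affine

variable {E X Y : Type*} [NormedAddCommGroup E] [NormedSpace ℝ E] [NormedAddCommGroup X]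
  [NormedSpace ℝ X] [NormedAddCommGroup Y] [NormedSpace ℝ Y]

/-- The product rule for a family `L s` of operators that is affine in `s`. -/
theorem hasFDerivAt_affine_family {L : ℝ → X →L[ℝ] Y} {A B : X →L[ℝ] Y}
    (hL : ∀ s, L s = A + s • B) {κ : E → ℝ} {κ' : E →L[ℝ] ℝ} {v : E → X} {v' : E →L[ℝ] X} {e : E}
    (hκ : HasFDerivAt κ κ' e) (hv : HasFDerivAt v v' e) :
    HasFDerivAt (fun b => L (κ b) (v b)) ((L (κ e)).comp v' + κ'.smulRight (B (v e))) e := by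
  have h := (A.hasFDerivAt.comp e hv).add (hκ.smul (B.hasFDerivAt.comp e hv))
  refine (h.congr_of_eventuallyEq (Eventually.of_forall fun b => ?_)).congr_fderiv ?_
  · simp [hL]
  · ext x
    simp [hL, add_assoc]

end Affine

section ChainRule

variable {E : Type*} [NormedAddCommGroup E] [NormedSpace ℝ E] [FiniteDimensional ℝ E]

theorem hasFDerivAt_divK_psi1 (hγ : 0 < γ) (hε : 0 < ε) {κ : E → ℝ} {κ' : E →L[ℝ] ℝ}
    {v : E → H1 Ω} {v' : E →L[ℝ] H1 Ω} {e : E}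
    (hκ : HasFDerivAt κ κ' e) (hv : HasFDerivAt v v' e)
    (hkink : ∀ᵐ x ∂Ω.meas, ‖gradK Ω (κ e) (v e) x‖ ≠ γ) :
    HasFDerivAt (fun b => divK Ω (κ b) (Psi1 γ ε (κ b) (v b)))
      ((divK Ω (κ e)).comp ((Psi2 γ ε (κ e) (v e)).comp
          ((gradK Ω (κ e)).comp v' + κ'.smulRight (wgrad Ω 1 (-1) (v e))))
        + κ'.smulRight (wdiv Ω 1 (-1) (Psi1 γ ε (κ e) (v e)))) e := by
  have h1 := hasFDerivAt_affine_family (gradK_eq (Ω := Ω)) hκ hv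
  have hl : LipschitzWith ((2 / γ).toNNReal + ‖ε‖₊) (gradient (Theta (Ω := Ω) γ ε)) := by
    rw [gradient_theta hγ hε]
    exact lipschitzWith_thetaGrad hγ ε
  have h2 := HasGateauxDerivAt.comp_hasFDerivAt (p := fun b => gradK Ω (κ b) (v b)) hl
    (hasGateauxDerivAt_gradient_theta hγ hε hkink) h1
  exact hasFDerivAt_affine_family (divK_eq (Ω := Ω)) hκ h2

/-- Stated along an arbitrary finite-dimensional family, so that it covers lines in `U`, variation
of the parameters alone, and the affine trial used for the solution map. -/
theorem hasFDerivAt_euler (hγ : 0 < γ) (hε : 0 < ε) (g : L2 Ω) {V : E → H1 Ω × H1 Ω}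
    {V' : E →L[ℝ] H1 Ω × H1 Ω} {β : E → ℝ × ℝ × ℝ} {β' : E →L[ℝ] ℝ × ℝ × ℝ} {e : E}
    (hV : HasFDerivAt V V' e) (hβ : HasFDerivAt β β' e) (hkink : AwayFromKink γ (β e).2.2 (V e)) :
    HasFDerivAt (fun b => euler g γ ε (V b) (β b))
      ((dS_dU γ ε (V e) (β e)).comp V' + (dS_da γ ε (V e) (β e)).comp β') e := by
  have hu := hV.fst
  have hw := hV.snd
  have ha := hβ.fst
  have hb := hβ.snd.fst
  have hκ := hβ.snd.snd
  have h1 := hasFDerivAt_divK_psi1 hγ hε hκ (hu.sub hw) (hkink.mono fun x hx => hx.1)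
  have h2 := hasFDerivAt_divK_psi1 hγ hε (hκ.const_sub 1) hw (hkink.mono fun x hx => hx.2)
  have hI := ((idDual Ω).hasFDerivAt.comp e hu).sub_const ((ip (L2 Ω) g).comp (toL2 Ω))
  have h3 := hI.sub (ha.smul h1)
  have h4 := (hI.sub (hb.smul h2)).add ((cTensor Ω).hasFDerivAt.comp e hw)
  have h5 := (Qstar Ω).hasFDerivAt.comp e (h3.prodMk h4)
  refine h5.congr_fderiv (ContinuousLinearMap.ext fun x => ?_)
  rw [add_apply, ContinuousLinearMap.comp_apply, ContinuousLinearMap.comp_apply,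
    ContinuousLinearMap.comp_apply, dS_dU, dS_da, ContinuousLinearMap.comp_apply,
    ContinuousLinearMap.comp_apply, ContinuousLinearMap.comp_apply, ← map_add]
  congr 1
  have hn : wgrad Ω (-1) 1 = -wgrad Ω 1 (-1) := by simpa using wgrad_neg (Ω := Ω) 1 (-1)
  have hn' : wdiv Ω (-1) 1 = -wdiv Ω 1 (-1) := by simpa using wdiv_neg (Ω := Ω) 1 (-1)
  rw [Q_apply]
  ext φ
  · simp [block, columns, T₁]
    ring
  · simp [block, columns, T₂, hn, hn']
    ring

end ChainRule

theorem hasGateauxDerivAt_S (hγ : 0 < γ) (hε : 0 < ε) (g : L2 Ω) {U : H1 Ω × H1 Ω}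
    {a : ℝ × ℝ × ℝ} (hkink : AwayFromKink γ a.2.2 U) :
    HasGateauxDerivAt (fun V => S g γ ε V a) (dS_dU γ ε U a) U := by
  intro h
  rw [S_eq_euler hγ hε]
  have hV : HasFDerivAt (fun t : ℝ => U + t • h) (ContinuousLinearMap.toSpanSingleton ℝ h) 0 :=
    (ContinuousLinearMap.toSpanSingleton ℝ h).hasFDerivAt.const_add U
  have := hasFDerivAt_euler (e := (0 : ℝ)) (V := fun t : ℝ => U + t • h) hγ hε g hV
    (hasFDerivAt_const a (0 : ℝ)) (by simpa using hkink)
  refine this.hasDerivAt.congr_deriv ?_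
  rw [add_apply, ContinuousLinearMap.comp_apply, ContinuousLinearMap.comp_apply, zero_apply,
    map_zero, add_zero, zero_smul, add_zero, ContinuousLinearMap.toSpanSingleton_apply, one_smul]

theorem hasFDerivAt_S (hγ : 0 < γ) (hε : 0 < ε) (g : L2 Ω) {U : H1 Ω × H1 Ω}
    {a : ℝ × ℝ × ℝ} (hkink : AwayFromKink γ a.2.2 U) :
    HasFDerivAt (fun b => S g γ ε U b) (dS_da γ ε U a) a := by
  rw [S_eq_euler hγ hε]
  refine (hasFDerivAt_euler hγ hε g (hasFDerivAt_const U a) (hasFDerivAt_id a)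
    hkink).congr_fderiv (ContinuousLinearMap.ext fun x => ?_)
  rw [add_apply, ContinuousLinearMap.comp_apply, ContinuousLinearMap.comp_apply, zero_apply,
    map_zero, zero_add]
  rfl

/-! ### Invertibility -/

theorem quadForm_le_dS_dU (hγ : 0 < γ) (hε : 0 < ε) {U : H1 Ω × H1 Ω} {a : ℝ × ℝ × ℝ}
    (ha : Admissible a) (hkink : AwayFromKink γ a.2.2 U) (d : H1 Ω × H1 Ω) :
    quadForm ε a d ≤ (dS_dU γ ε U a d).1 d.1 + (dS_dU γ ε U a d).2 d.2 := by
  have h1 := mul_le_mul_of_nonneg_left (inner_gateauxDeriv_theta_ge hγ hε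
    (hkink.mono fun x hx => hx.1) (gradK Ω a.2.2 (d.1 - d.2))) ha.1.le
  have h2 := mul_le_mul_of_nonneg_left (inner_gateauxDeriv_theta_ge hγ hε
    (hkink.mono fun x hx => hx.2) (gradK Ω (1 - a.2.2) d.2)) ha.2.1.le
  have e : (dS_dU γ ε U a d).1 d.1 + (dS_dU γ ε U a d).2 d.2 = ‖toL2 Ω d.1‖ ^ 2
      + a.1 * inner ℝ (Psi2 γ ε a.2.2 (U.1 - U.2) (gradK Ω a.2.2 (d.1 - d.2)))
        (gradK Ω a.2.2 (d.1 - d.2))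
      + a.2.1 * inner ℝ (Psi2 γ ε (1 - a.2.2) U.2 (gradK Ω (1 - a.2.2) d.2))
        (gradK Ω (1 - a.2.2) d.2)
      + cDual Ω d.2 ^ 2 := by
    rw [dS_dU, ContinuousLinearMap.comp_apply, Qstar_adjoint, ContinuousLinearMap.comp_apply,
      Q_apply]
    rw [← real_inner_self_eq_norm_sq]
    simp only [block, ContinuousLinearMap.prod_apply, ContinuousLinearMap.coprod_apply, add_apply,
      sub_apply, smul_apply, ContinuousLinearMap.comp_apply, idDual_apply, divK_apply,
      cTensor_apply, smul_eq_mul, map_sub, inner_sub_left, inner_sub_right]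
    ring
  rw [e, quadForm]
  unfold Psi2
  linarith

/-- The Lax-Milgram theorem on a product of two Hilbert spaces. -/
theorem isInvertible_of_coercive {X : Type*} [NormedAddCommGroup X] [InnerProductSpace ℝ X]
    [CompleteSpace X] (T : X × X →L[ℝ] (X →L[ℝ] ℝ) × (X →L[ℝ] ℝ)) {c : ℝ} (hc : 0 < c)
    (hT : ∀ d, c * ‖d‖ ^ 2 ≤ (T d).1 d.1 + (T d).2 d.2) : T.IsInvertible := by
  -- The product carries the sup norm, which is not Hilbertian; Lax-Milgram is applied in the `ℓ²`
  -- product.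
  let e := WithLp.prodContinuousLinearEquiv 2 ℝ X X
  let P : (X →L[ℝ] ℝ) × (X →L[ℝ] ℝ) →L[ℝ] X × X →L[ℝ] ℝ :=
    ((ContinuousLinearMap.compL ℝ (X × X) X ℝ).flip (ContinuousLinearMap.fst ℝ X X)).coprod
      ((ContinuousLinearMap.compL ℝ (X × X) X ℝ).flip (ContinuousLinearMap.snd ℝ X X))
  have hP : ∀ A d, P A d = A.1 d.1 + A.2 d.2 := fun A d => by simp [P]
  let B : WithLp 2 (X × X) →L[ℝ] WithLp 2 (X × X) →L[ℝ] ℝ :=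
    (P.comp T).bilinearComp (e : WithLp 2 (X × X) →L[ℝ] X × X) (e : WithLp 2 (X × X) →L[ℝ] X × X)
  have hB : ∀ z y, B z y = (T (e z)).1 (e y).1 + (T (e z)).2 (e y).2 := fun z y => hP _ _
  have hcoer : IsCoercive B := by
    -- The squared `ℓ²` norm is at most twice the squared sup norm.
    refine ⟨c / 2, by positivity, fun z => ?_⟩
    have h1 := hT (e z)
    rw [hB]
    have h2 : ‖z‖ ^ 2 = ‖(e z).1‖ ^ 2 + ‖(e z).2‖ ^ 2 := WithLp.prod_norm_sq_eq_of_L2 z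
    have h3 := pow_le_pow_left₀ (norm_nonneg _) (norm_fst_le (e z)) 2
    have h4 := pow_le_pow_left₀ (norm_nonneg _) (norm_snd_le (e z)) 2
    nlinarith
  have hinj : Function.Injective T := by
    rw [injective_iff_map_eq_zero]
    intro d hd
    have := hT d
    rw [hd] at this
    simp only [Prod.fst_zero, Prod.snd_zero, zero_apply, add_zero] at this
    by_contra hne
    have : 0 < c * ‖d‖ ^ 2 := mul_pos hc (pow_pos (norm_pos_iff.2 hne) 2)
    linarith
  have hsurj : Function.Surjective T := by
    intro A
    let r := (InnerProductSpace.toDual ℝ (WithLp 2 (X × X))).symm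
      ((P A).comp (e : WithLp 2 (X × X) →L[ℝ] X × X))
    obtain ⟨z, hz⟩ := hcoer.continuousLinearEquivOfBilin.surjective r
    refine ⟨e z, ?_⟩
    have key : ∀ y : WithLp 2 (X × X),
        (T (e z)).1 (e y).1 + (T (e z)).2 (e y).2 = A.1 (e y).1 + A.2 (e y).2 := by
      intro y
      rw [← hB, ← hcoer.continuousLinearEquivOfBilin_apply, hz,
        InnerProductSpace.toDual_symm_apply]
      exact hP _ _
    ext x
    · simpa using key (e.symm (x, 0))
    · simpa using key (e.symm (0, x))
  exact ⟨ContinuousLinearEquiv.ofBijective T (LinearMap.ker_eq_bot.2 hinj)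
    (LinearMap.range_eq_top.2 hsurj), ContinuousLinearEquiv.coe_ofBijective _ _ _⟩

theorem isInvertible_dS_dU (hγ : 0 < γ) (hε : 0 < ε) {U : H1 Ω × H1 Ω} {a : ℝ × ℝ × ℝ}
    (ha : Admissible a) (hkink : AwayFromKink γ a.2.2 U) : (dS_dU γ ε U a).IsInvertible := by
  obtain ⟨c, hc0, hc⟩ := exists_modulus_mul_le_quadForm Ω hε
  exact isInvertible_of_coercive _ (mul_pos hc0 (modulus_pos hε ha)) fun d =>
    (hc a ha d).trans (quadForm_le_dS_dU hγ hε ha hkink d)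

/-! ### The solution map -/

/-- Residual estimate: strong monotonicity between `V` and the zero of the Euler-Lagrange operator,
divided by the distance; the `2` is from `pairing_le`. -/
theorem norm_sub_Rhat_le (hγ : 0 < γ) (hε : 0 < ε) (g : L2 Ω) {c : ℝ}
    (hc : ∀ a, Admissible a → ∀ d : H1 Ω × H1 Ω, c * modulus ε a * ‖d‖ ^ 2 ≤ quadForm ε a d)
    {b : ℝ × ℝ × ℝ} (hb : Admissible b) (V : H1 Ω × H1 Ω) :
    c * modulus ε b * ‖Rhat g γ ε b - V‖ ≤ 2 * ‖euler g γ ε V b‖ := by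
  have h1 := (hc b hb _).trans (quadForm_le_euler_sub hγ hε g hb V (Rhat g γ ε b))
  rw [(isMinimiser_Rhat hγ hε g hb).euler_eq_zero hγ hε, zero_sub] at h1
  have h2 := h1.trans (pairing_le _ _)
  rw [norm_neg] at h2
  rcases (norm_nonneg (Rhat g γ ε b - V)).eq_or_lt with h | h
  · rw [← h, mul_zero]
    positivity
  · refine le_of_mul_le_mul_right ?_ h
    linarith

theorem hasFDerivAt_Rhat (hγ : 0 < γ) (hε : 0 < ε) (g : L2 Ω) {a : ℝ × ℝ × ℝ}
    (ha : Admissible a) (hkink : AwayFromKink γ a.2.2 (Rhat g γ ε a)) :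
    HasFDerivAt (Rhat g γ ε) (-((dS_dU γ ε (Rhat g γ ε a) a).inverse.comp
      (dS_da γ ε (Rhat g γ ε a) a))) a := by
  obtain ⟨c, hc0, hc⟩ := exists_modulus_mul_le_quadForm Ω hε
  have hμ := modulus_pos hε ha
  set U := Rhat g γ ε a with hU
  set L := -((dS_dU γ ε U a).inverse.comp (dS_da γ ε U a)) with hL
  have hinv := isInvertible_dS_dU hγ hε ha hkink
  have hV : HasFDerivAt (fun b => U + L (b - a)) L a := by
    simpa using (L.hasFDerivAt.comp a ((hasFDerivAt_id a).sub_const a)).const_add U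
  have hF := hasFDerivAt_euler (V := fun b => U + L (b - a)) hγ hε g hV (hasFDerivAt_id a)
    (by simpa using hkink)
  -- The choice of `L` makes the residual of the affine trial stationary at `a`.
  have hzero : (dS_dU γ ε U a).comp L + dS_da γ ε U a = 0 := by
    refine ContinuousLinearMap.ext fun x => ?_
    rw [add_apply, ContinuousLinearMap.comp_apply, hL, neg_apply, map_neg,
      ContinuousLinearMap.comp_apply, hinv.self_apply_inverse, neg_add_cancel, zero_apply]
  simp only [id, sub_self, map_zero, add_zero, ContinuousLinearMap.comp_id] at hF
  rw [hzero, hasFDerivAt_iff_isLittleO] at hF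
  simp only [sub_self, map_zero, add_zero, zero_apply, sub_zero] at hF
  rw [hU, (isMinimiser_Rhat hγ hε g ha).euler_eq_zero hγ hε, ← hU] at hF
  simp only [sub_zero] at hF
  rw [hasFDerivAt_iff_isLittleO]
  refine Asymptotics.IsBigO.trans_isLittleO ?_ hF
  refine Asymptotics.IsBigO.of_bound (2 / (c * (modulus ε a / 2))) ?_
  -- Near `a` the modulus exceeds half its value there, so one constant serves for all nearby `b`.
  have hev := (continuous_modulus ε).continuousAt.eventually_const_lt (half_lt_self hμ)
  filter_upwards [isOpen_admissible.mem_nhds ha, hev] with b hb hb2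
  have h1 := norm_sub_Rhat_le hγ hε g hc hb (U + L (b - a))
  rw [← sub_sub] at h1
  rw [div_mul_eq_mul_div, le_div_iff₀ (by positivity), mul_comm]
  refine le_trans ?_ h1
  exact mul_le_mul_of_nonneg_right (mul_le_mul_of_nonneg_left hb2.le hc0.le) (norm_nonneg _)

end

end ICTVTV

end

theorem mainTheorem2 (Ω : ICTVTV.Domain) (g : ICTVTV.L2 Ω) (γ ε : ℝ) (hγ : 0 < γ) (hε : 0 < ε) :
    -- the solution map is well defined
    (∀ a : ℝ × ℝ × ℝ, ICTVTV.Admissible a →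
      (∃! U : ICTVTV.H1 Ω × ICTVTV.H1 Ω, ICTVTV.IsMinimiser g γ ε a U) ∧
      ICTVTV.IsMinimiser g γ ε a (ICTVTV.Rhat g γ ε a)) ∧
    -- the gradients of `Θ` and of `J` exist
    Differentiable ℝ (ICTVTV.Theta (Ω := Ω) γ ε) ∧
    (∀ a : ℝ × ℝ × ℝ, Differentiable ℝ
      (fun U : ICTVTV.H1 Ω × ICTVTV.H1 Ω => ICTVTV.J g γ ε U a)) ∧
    -- the Hessian of `Θ` and the partial derivatives of `S`
    (∀ a : ℝ × ℝ × ℝ, ICTVTV.Admissible a → ∀ U : ICTVTV.H1 Ω × ICTVTV.H1 Ω,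
      ICTVTV.AwayFromKink γ a.2.2 U →
      ICTVTV.HasGateauxDerivAt (gradient (ICTVTV.Theta (Ω := Ω) γ ε))
        (ICTVTV.Psi2 γ ε a.2.2 (U.1 - U.2)) (ICTVTV.gradK Ω a.2.2 (U.1 - U.2)) ∧
      ICTVTV.HasGateauxDerivAt (gradient (ICTVTV.Theta (Ω := Ω) γ ε))
        (ICTVTV.Psi2 γ ε (1 - a.2.2) U.2) (ICTVTV.gradK Ω (1 - a.2.2) U.2) ∧
      ICTVTV.HasGateauxDerivAt (fun V => ICTVTV.S g γ ε V a) (ICTVTV.dS_dU γ ε U a) U ∧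
      HasFDerivAt (fun b => ICTVTV.S g γ ε U b) (ICTVTV.dS_da γ ε U a) a ∧
      (ICTVTV.dS_dU γ ε U a).IsInvertible) ∧
    -- the gradient of `R`
    (∀ a : ℝ × ℝ × ℝ, ICTVTV.Admissible a →
      ICTVTV.AwayFromKink γ a.2.2 (ICTVTV.Rhat g γ ε a) →
      HasFDerivAt (ICTVTV.R g γ ε)
        (-((ICTVTV.P₁ Ω).comp
          ((ICTVTV.dS_dU γ ε (ICTVTV.Rhat g γ ε a) a).inverse.comp
            (ICTVTV.dS_da γ ε (ICTVTV.Rhat g γ ε a) a)))) a) := by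
  refine ⟨fun a ha => ?_, fun p => ?_, fun a U => ?_, fun a ha U hkink => ?_, fun a ha hkink => ?_⟩
  · have h := ICTVTV.isMinimiser_Rhat hγ hε g ha
    exact ⟨⟨_, h, fun V hV => hV.unique hγ hε ha h⟩, h⟩
  · exact (ICTVTV.hasGradientAt_theta hγ hε p).differentiableAt
  · exact (ICTVTV.hasFDerivAt_J hγ hε g a U).differentiableAt
  · exact ⟨ICTVTV.hasGateauxDerivAt_gradient_theta hγ hε (hkink.mono fun x hx => hx.1),
      ICTVTV.hasGateauxDerivAt_gradient_theta hγ hε (hkink.mono fun x hx => hx.2),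
      ICTVTV.hasGateauxDerivAt_S hγ hε g hkink, ICTVTV.hasFDerivAt_S hγ hε g hkink,
      ICTVTV.isInvertible_dS_dU hγ hε ha hkink⟩
  · rw [← ContinuousLinearMap.comp_neg]
    exact (ICTVTV.P₁ Ω).hasFDerivAt.comp a (ICTVTV.hasFDerivAt_Rhat hγ hε g ha hkink)
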